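/- Let $k\ge 0$, let $S$ be the set of $k$-matchings (sets of $k$ pairwise disjoint edges, i.e. perfect matchings) of the complete graph $K_{2k}$, and let the symmetric group $S_{2k}$ act on $\mathbb{C}[S]$ by permuting the vertices. For a partition $\lambda$ of $2k$ let $M^\lambda$ be the complex permutation module of $S_{2k}$ whose basis is the set of tabloids of shape $\lambda$. For a tableau $t$ of shape $\lambda$ with tabloid $\{t\}$ and column group $C_t$ let $e_t=\sum_{\pi\in C_t}\operatorname{sign}(\pi)\,\pi\{t\}$ be its polytabloid, and let the Specht module $S^\lambda\subseteq M^\lambda$ be the span of all $e_t$. Call $\lambda$ even if all its parts are even. For an even $\lambda$ let $f_\lambda\colon M^\lambda\to\mathbb{C}[S]$ be the linear map that sends a tabloid with rows $R_1,\dots,R_r$ to $\prod_{i=1}^r f(R_i)$, where $f(R_i)$ is the sum of all perfect matchings of the set $R_i$ and the product of disjoint matchings is their union. Then: (1) for each even partition $\lambda$ of $2k$, $f_\lambda$ is a homomorphism of $S_{2k}$-modules, $f_\lambda(e_t)\neq 0$ for the standard tableau $t$ of shape $\lambda$ whose entries $1,\dots,2k$ increase when the cells are read row by row, and the restriction of $f_\lambda$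 to $S^\lambda$ is injective; (2) the linear map $\bigoplus_{\lambda} S^\lambda\to\mathbb{C}[S]$, the sum being over all even partitions $\lambda$ of $2k$, that equals $f_\lambda$ on the summand $S^\lambda$ is an isomorphism of $S_{2k}$-modules; (3) for each even partition $\lambda$ of $2k$, the module $S^\lambda$ is irreducible and has multiplicity $1$ in $\mathbb{C}[S]$, i.e. $\dim_{\mathbb{C}}\operatorname{Hom}_{S_{2k}}(S^\lambda,\mathbb{C}[S])=1$. -/

import Mathlib

open scoped MonoidAlgebra DirectSum

namespace SpechtMatching

/-! ### Partitions and Young diagrams -/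

/-- The Young diagram of a partition: row `i` (counted from `0`) has length the `i`-th largest
part. -/
def diagram {n : ℕ} (p : n.Partition) : YoungDiagram :=
  YoungDiagram.ofRowLens (p.parts.sort (· ≥ ·)) (p.parts.pairwise_sort (· ≥ ·)).sortedGE

theorem card_cellsOfRowLens (w : List ℕ) : (YoungDiagram.cellsOfRowLens w).card = w.sum := by
  induction w with
  | nil => rfl
  | cons a w ih =>
    rw [YoungDiagram.cellsOfRowLens, Finset.card_union_of_disjoint]
    · simp [ih]
    · rw [Finset.disjoint_left]
      rintro ⟨i, j⟩ h1 h2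
      simp only [Finset.mem_product, Finset.mem_singleton] at h1
      simp only [Finset.mem_map, Prod.exists] at h2
      obtain ⟨a, b, -, h⟩ := h2
      have := congrArg Prod.fst h
      simp at this
      omega

theorem card_diagram {n : ℕ} (p : n.Partition) : (diagram p).cells.card = n := by
  change (YoungDiagram.cellsOfRowLens _).card = n
  rw [card_cellsOfRowLens, ← Multiset.sum_coe, Multiset.sort_eq, p.parts_sum]

/-- The partitions of `2k` all of whose parts are even. -/
abbrev EvenPartition (k : ℕ) : Type :=
  {p : (2 * k).Partition // ∀ i ∈ p.parts, Even i}

/-! ### Tableaux, tabloids, polytabloids, Specht modules -/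

/-- A (bijective) tableau of shape `μ` with entries `0, …, n - 1`: the cell `(i, j)` is in row `i`
and column `j`. -/
abbrev Tableau (μ : YoungDiagram) (n : ℕ) : Type :=
  {c : ℕ × ℕ // c ∈ μ.cells} ≃ Fin n

/-- The row of a tableau that contains the entry `x`. -/
def Tableau.rowOf {μ : YoungDiagram} {n : ℕ} (t : Tableau μ n) (x : Fin n) : ℕ :=
  (t.symm x).1.1

/-- The column of a tableau that contains the entry `x`. -/
def Tableau.colOf {μ : YoungDiagram} {n : ℕ} (t : Tableau μ n) (x : Fin n) : ℕ :=
  (t.symm x).1.2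

/-- The tableau `σ t`, obtained by applying `σ` to every entry of `t`. -/
def Tableau.perm {μ : YoungDiagram} {n : ℕ} (σ : Equiv.Perm (Fin n)) (t : Tableau μ n) :
    Tableau μ n :=
  Equiv.trans t σ

/-- The tableau of shape `μ` whose entries increase when the cells are read row by row, from the
top row to the bottom row and from left to right in each row. -/
def standardTableau {μ : YoungDiagram} {n : ℕ} (h : μ.cells.card = n) : Tableau μ n :=
  (toLex.subtypeEquiv (q := fun c => c ∈ μ.cells.map toLex.toEmbedding)
      fun _ => (Finset.mem_map' _).symm).trans
    (((μ.cells.map toLex.toEmbedding).orderIsoOfFin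
      ((Finset.card_map _).trans h)).symm.toEquiv)

/-- Tabloids of shape `μ`: tableaux of shape `μ` up to permutations of the entries in each row. Two
tableaux are row equivalent iff they assign the same row to every entry, so that the class
of `t` is recorded as the function `t.rowOf`. -/
@[ext]
structure Tabloid (μ : YoungDiagram) (n : ℕ) where
  /-- The row that contains a given entry. -/
  rowOf : Fin n → ℕ
  exists_tableau : ∃ t : Tableau μ n, t.rowOf = rowOf

/-- The tabloid `{t}` of a tableau `t`. -/
def Tableau.tabloid {μ : YoungDiagram} {n : ℕ} (t : Tableau μ n) : Tabloid μ n :=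
  ⟨t.rowOf, t, rfl⟩

/-- The symmetric group acts on tabloids by permuting the entries, `σ{t} = {σ t}`. -/
instance (μ : YoungDiagram) (n : ℕ) : MulAction (Equiv.Perm (Fin n)) (Tabloid μ n) where
  smul σ T := ⟨fun x => T.rowOf (σ⁻¹ x), by
    obtain ⟨t, ht⟩ := T.exists_tableau
    exact ⟨t.perm σ, by rw [← ht]; rfl⟩⟩
  one_smul _ := rfl
  mul_smul _ _ _ := rfl

theorem smul_tabloid {μ : YoungDiagram} {n : ℕ} (σ : Equiv.Perm (Fin n)) (t : Tableau μ n) :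
    σ • t.tabloid = (t.perm σ).tabloid := rfl

/-- The permutation module `M^μ` with basis the tabloids of shape `μ`. -/
noncomputable abbrev permModule (μ : YoungDiagram) (n : ℕ) :
    Representation ℂ (Equiv.Perm (Fin n)) ℂ[Tabloid μ n] :=
  Representation.ofMulAction ℂ (Equiv.Perm (Fin n)) (Tabloid μ n)

/-- The column group of a tableau: the permutations that map every entry to an entry of the same
column. -/
def columnGroup {μ : YoungDiagram} {n : ℕ} (t : Tableau μ n) : Finset (Equiv.Perm (Fin n)) :=
  Finset.univ.filter fun σ => ∀ x, t.colOf (σ x) = t.colOf x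

/-- The polytabloid `e_t`, the sum of `sign(σ) σ{t}` over the column group of `t`. -/
noncomputable def polytabloid {μ : YoungDiagram} {n : ℕ} (t : Tableau μ n) : ℂ[Tabloid μ n] :=
  ∑ σ ∈ columnGroup t, MonoidAlgebra.single (σ • t.tabloid) ((Equiv.Perm.sign σ : ℤ) : ℂ)

theorem permModule_polytabloid {μ : YoungDiagram} {n : ℕ} (g : Equiv.Perm (Fin n))
    (t : Tableau μ n) : permModule μ n g (polytabloid t) = polytabloid (t.perm g) := by
  unfold polytabloid
  rw [map_sum]
  refine Finset.sum_bij' (fun σ _ => g * σ * g⁻¹) (fun σ _ => g⁻¹ * σ * g) ?_ ?_ ?_ ?_ ?_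
  · intro σ hσ
    simp only [columnGroup, Finset.mem_filter, Finset.mem_univ, true_and] at hσ ⊢
    intro x
    have h := hσ (g⁻¹ x)
    have e : g⁻¹ (g (σ (g⁻¹ x))) = σ (g⁻¹ x) := Equiv.symm_apply_apply g _
    change t.colOf (g⁻¹ (g (σ (g⁻¹ x)))) = t.colOf (g⁻¹ x)
    rw [e, h]
  · intro σ hσ
    simp only [columnGroup, Finset.mem_filter, Finset.mem_univ, true_and] at hσ ⊢
    intro x
    have h := hσ (g x)
    change t.colOf (g⁻¹ (σ (g x))) = t.colOf (g⁻¹ (g x)) at h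
    have e : g⁻¹ (g x) = x := Equiv.symm_apply_apply g _
    rw [e] at h
    exact h
  · intro σ _; group
  · intro σ _; group
  · intro σ _
    rw [Representation.ofMulAction_single, ← smul_tabloid, smul_smul, smul_smul]
    congr 1
    · group
    · simp [mul_comm, ← mul_assoc]

/-- The Specht module `S^μ`: the subrepresentation of `M^μ` spanned by all polytabloids. -/
noncomputable def spechtSub (μ : YoungDiagram) (n : ℕ) : Subrepresentation (permModule μ n) where
  toSubmodule := Submodule.span ℂ (Set.range fun t : Tableau μ n => polytabloid t)
  apply_mem_toSubmodule g v hv := by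
    induction hv using Submodule.span_induction with
    | mem x hx =>
      obtain ⟨t, rfl⟩ := hx
      rw [permModule_polytabloid]
      exact Submodule.subset_span ⟨_, rfl⟩
    | zero => simp
    | add x y _ _ hx hy => rw [map_add]; exact Submodule.add_mem _ hx hy
    | smul a x _ hx => rw [map_smul]; exact Submodule.smul_mem _ a hx

/-- The Specht module `S^p` of a partition `p` of `n`, as a representation of the symmetric group
on `n` letters. -/
noncomputable abbrev specht {n : ℕ} (p : n.Partition) :
    Representation ℂ (Equiv.Perm (Fin n)) (spechtSub (diagram p) n).toSubmodule :=
  (spechtSub (diagram p) n).toRepresentation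

/-! ### Matchings -/

/-- A set of edges of `G` is a matching if distinct edges in it are disjoint. -/
def IsMatching {V : Type*} (G : SimpleGraph V) (M : Finset (Sym2 V)) : Prop :=
  (∀ e ∈ M, e ∈ G.edgeSet) ∧ ∀ e ∈ M, ∀ e' ∈ M, e ≠ e' → ∀ v, v ∈ e → v ∉ e'

/-- The `k`-matchings (matchings with `k` edges) in the complete graph `K_{2k}`. -/
@[ext]
structure Matchings (k : ℕ) where
  edges : Finset (Sym2 (Fin (2 * k)))
  isMatching : IsMatching ⊤ edges
  card_edges : edges.card = k

theorem IsMatching.image {V : Type*} [DecidableEq V] {M : Finset (Sym2 V)}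
    (h : IsMatching ⊤ M) (σ : Equiv.Perm V) : IsMatching ⊤ (M.image (Sym2.map σ)) := by
  refine ⟨fun e he => ?_, fun e he e' he' hne v hv hv' => ?_⟩
  · obtain ⟨d, hd, rfl⟩ := Finset.mem_image.1 he
    have := h.1 d hd
    induction d using Sym2.ind with
    | _ x y => simpa using this
  · obtain ⟨d, hd, rfl⟩ := Finset.mem_image.1 he
    obtain ⟨d', hd', rfl⟩ := Finset.mem_image.1 he'
    obtain ⟨a, ha, rfl⟩ := Sym2.mem_map.1 hv
    obtain ⟨b, hb, hab⟩ := Sym2.mem_map.1 hv'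
    obtain rfl := σ.injective hab
    exact h.2 d hd d' hd' (fun e => hne (e ▸ rfl)) b ha hb

/-- The symmetric group acts on matchings by permuting the vertices. -/
instance (k : ℕ) : MulAction (Equiv.Perm (Fin (2 * k))) (Matchings k) where
  smul σ M := ⟨M.edges.image (Sym2.map σ), M.isMatching.image σ, by
    rw [Finset.card_image_of_injective _ (Sym2.map.injective σ.injective), M.card_edges]⟩
  one_smul M := Matchings.ext (by
    change M.edges.image (Sym2.map id) = M.edges
    simp)
  mul_smul σ τ M := Matchings.ext (by
    change M.edges.image (Sym2.map (σ ∘ τ)) = (M.edges.image (Sym2.map τ)).image (Sym2.map σ)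
    rw [Finset.image_image, Sym2.map_comp])

/-- The module `ℂ[S]`, where `S` is the set of `k`-matchings in `K_{2k}`. -/
noncomputable abbrev matchingModule (k : ℕ) :
    Representation ℂ (Equiv.Perm (Fin (2 * k))) ℂ[Matchings k] :=
  Representation.ofMulAction ℂ (Equiv.Perm (Fin (2 * k))) (Matchings k)

/-! ### The map from tabloids to matchings -/

/-- The set of entries in row `i` of a tabloid. -/
def Tabloid.row {μ : YoungDiagram} {n : ℕ} (T : Tabloid μ n) (i : ℕ) : Finset (Fin n) :=
  Finset.univ.filter fun x => T.rowOf x = i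

/-- The perfect matchings of a finite vertex set `R`: the matchings with edges inside `R` that have
`|R| / 2` edges. -/
def IsPerfectMatchingOf {V : Type*} (R : Finset V) (M : Finset (Sym2 V)) : Prop :=
  IsMatching ⊤ M ∧ (∀ e ∈ M, ∀ v ∈ e, v ∈ R) ∧ 2 * M.card = R.card

/-- A choice of a perfect matching of each row of the tabloid `T`. -/
@[ext]
structure RowMatchings {μ : YoungDiagram} {n : ℕ} (T : Tabloid μ n) where
  /-- The matching of the `i`-th row; the rows are indexed from `0`, and `μ.colLen 0` is their
  number. -/
  matching : Fin (μ.colLen 0) → Finset (Sym2 (Fin n))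
  isPerfect : ∀ i : Fin (μ.colLen 0), IsPerfectMatchingOf (T.row i) (matching i)

noncomputable instance {μ : YoungDiagram} {n : ℕ} (T : Tabloid μ n) : Fintype (RowMatchings T) :=
  Fintype.ofInjective RowMatchings.matching fun _ _ h => RowMatchings.ext h

theorem Tabloid.lt_colLen {μ : YoungDiagram} {n : ℕ} (T : Tabloid μ n) (x : Fin n) :
    T.rowOf x < μ.colLen 0 := by
  obtain ⟨t, ht⟩ := T.exists_tableau
  rw [← ht, ← YoungDiagram.mem_iff_lt_colLen]
  exact μ.up_left_mem le_rfl (Nat.zero_le _) (t.symm x).2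

theorem RowMatchings.eq_of_mem {μ : YoungDiagram} {n : ℕ} {T : Tabloid μ n} (m : RowMatchings T)
    {i j : Fin (μ.colLen 0)} {e e' : Sym2 (Fin n)} (he : e ∈ m.matching i)
    (he' : e' ∈ m.matching j) {v : Fin n} (hv : v ∈ e) (hv' : v ∈ e') : i = j := by
  have h1 := (m.isPerfect i).2.1 e he v hv
  have h2 := (m.isPerfect j).2.1 e' he' v hv'
  simp only [Tabloid.row, Finset.mem_filter, Finset.mem_univ, true_and] at h1 h2
  exact Fin.ext (h1.symm.trans h2)

theorem Tabloid.sum_card_row {μ : YoungDiagram} {n : ℕ} (T : Tabloid μ n) :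
    ∑ i : Fin (μ.colLen 0), (T.row i).card = n := by
  have h := Finset.card_eq_sum_card_fiberwise (s := (Finset.univ : Finset (Fin n)))
    (t := (Finset.univ : Finset (Fin (μ.colLen 0))))
    (f := fun x => ⟨T.rowOf x, T.lt_colLen x⟩) (fun _ _ => Finset.mem_coe.2 (Finset.mem_univ _))
  rw [Finset.card_univ, Fintype.card_fin] at h
  refine Eq.trans ?_ h.symm
  refine Finset.sum_congr rfl fun i _ => congrArg Finset.card ?_
  ext x
  simp [Tabloid.row, Fin.ext_iff]

/-- The union of perfect matchings of all the rows of a tabloid. -/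
def RowMatchings.union {μ : YoungDiagram} {k : ℕ} {T : Tabloid μ (2 * k)} (m : RowMatchings T) :
    Matchings k where
  edges := Finset.univ.biUnion m.matching
  isMatching := by
    refine ⟨fun e he => ?_, fun e he e' he' hne v hv hv' => ?_⟩
    · obtain ⟨i, -, hi⟩ := Finset.mem_biUnion.1 he
      exact (m.isPerfect i).1.1 e hi
    · obtain ⟨i, -, hi⟩ := Finset.mem_biUnion.1 he
      obtain ⟨j, -, hj⟩ := Finset.mem_biUnion.1 he'
      obtain rfl := m.eq_of_mem hi hj hv hv'
      exact (m.isPerfect i).1.2 e hi e' hj hne v hv hv'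
  card_edges := by
    have hcard : (Finset.univ.biUnion m.matching).card = ∑ i, (m.matching i).card := by
      refine Finset.card_biUnion fun i _ j _ hij => Finset.disjoint_left.2 fun e hi hj => ?_
      induction e using Sym2.ind with
      | _ x y => exact hij (m.eq_of_mem (v := x) hi hj (by simp) (by simp))
    have h2 : 2 * ∑ i, (m.matching i).card = 2 * k := by
      rw [Finset.mul_sum]
      exact (Finset.sum_congr rfl fun i _ => (m.isPerfect i).2.2).trans T.sum_card_row
    omega

/-- The linear map `f : M^μ → ℂ[S]` that sends a tabloid with rows `R_i` to the product over `i` of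
the sums of all perfect matchings of `R_i`, where the product of disjoint matchings is their union.
The product is written in expanded form, as a sum over all choices of a perfect matching of each
row. -/
noncomputable def f (μ : YoungDiagram) (k : ℕ) : ℂ[Tabloid μ (2 * k)] →ₗ[ℂ] ℂ[Matchings k] :=
  (MonoidAlgebra.basis (Tabloid μ (2 * k)) ℂ).constr ℂ fun T =>
    ∑ m : RowMatchings T, MonoidAlgebra.single m.union 1

end SpechtMatching

/-!
Fix a tableau `t` and let `e_t` be its polytabloid. The column antisymmetrizer
`∑ σ ∈ C_t, sign(σ) σ` annihilates every tabloid with two entries of a row in one column of `t`, and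
it maps `u ∈ M^μ` to `⟨u, e_t⟩ e_t`. The first fact says that it kills `M^ν` unless `μ` dominates
`ν`. The second one yields James' submodule theorem, so that `S^μ` is irreducible.

Let all the rows of `μ` be even and match the entries in the columns `2j` and `2j + 1` of each row
of `t`. If `σ ∈ C_t` and this matching refines the rows of `σ{t}`, then `σ` commutes with the
matching, hence it acts in the same way on the even and on the odd columns and is even. Thus the
coefficient of the matching in `f(e_t)` counts such `σ`, and `f(e_t) ≠ 0`. If `f(u) = 0` with
`u ∈ S^μ`, then the antisymmetrizers show that `⟨u, e_t⟩ f(e_t) = 0` for all `t`, so `u` is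
orthogonal to `S^μ` and vanishes. For a sum of such elements over several shapes, apply the same
argument to a minimal shape in the dominance order.

For surjectivity, two perfect matchings split the vertices into two halves that both of them
exchange. Relative to the first matching, the second one is then a permutation of one half, and
its conjugacy class determines the pair up to isomorphism. Therefore `End(ℂ[S])` has dimension at
most the number of partitions of `k`, which is the number of even partitions of `2k`. By Maschke's
theorem the projections onto the summands of `⨁ S^λ ⊆ ℂ[S]` extend to orthogonal idempotents in
`End(ℂ[S])`. Their number is at least the dimension, so they form a basis of `End(ℂ[S])` and have
sum `1`.
-/

namespace SpechtMatching

open Representation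

section OrthogonalIdempotents

theorem sum_smul_mul_of_orthogonalIdempotents {K A ι : Type*} [CommSemiring K] [Semiring A]
    [Algebra K A] {e : ι → A} (he : OrthogonalIdempotents e) {s : Finset ι} {i : ι} (hi : i ∈ s)
    (c : ι → K) : (∑ j ∈ s, c j • e j) * e i = c i • e i := by
  classical
  simp [Finset.sum_mul, he.mul_eq, hi]

variable {K A ι : Type*} [Field K] [Semiring A] [Algebra K A] {e : ι → A}

theorem linearIndependent_of_orthogonalIdempotents (he : OrthogonalIdempotents e)
    (hne : ∀ i, e i ≠ 0) : LinearIndependent K e := by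
  let := Algebra.semiringToRing K (A := A)
  refine linearIndependent_iff'.2 fun s c hc i hi => ?_
  have hmul := sum_smul_mul_of_orthogonalIdempotents he hi c
  rw [hc, zero_mul] at hmul
  exact (smul_eq_zero.1 hmul.symm).resolve_right (hne i)

variable [Fintype ι] [Module.Finite K A]

theorem exists_sum_smul_of_orthogonalIdempotents (he : OrthogonalIdempotents e)
    (hne : ∀ i, e i ≠ 0) (hcard : Module.finrank K A ≤ Fintype.card ι) (x : A) :
    ∃ c : ι → K, ∑ i, c i • e i = x := by
  let := Algebra.semiringToRing K (A := A)
  have hli : LinearIndependent K e := linearIndependent_of_orthogonalIdempotents he hne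
  have htop := hli.span_eq_top_of_card_eq_finrank' (hli.fintype_card_le_finrank.antisymm hcard)
  exact (Submodule.mem_span_range_iff_exists_fun K).1 (htop ▸ Submodule.mem_top)

theorem exists_smul_eq_of_mul_orthogonalIdempotent (he : OrthogonalIdempotents e)
    (hne : ∀ i, e i ≠ 0) (hcard : Module.finrank K A ≤ Fintype.card ι) {x : A} {i : ι}
    (hx : x * e i = x) : ∃ c : K, c • e i = x := by
  obtain ⟨c, rfl⟩ := exists_sum_smul_of_orthogonalIdempotents he hne hcard x
  exact ⟨c i, (sum_smul_mul_of_orthogonalIdempotents he (Finset.mem_univ i) c).symm.trans hx⟩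

theorem completeOrthogonalIdempotents_of_finrank_le (he : OrthogonalIdempotents e)
    (hne : ∀ i, e i ≠ 0) (hcard : Module.finrank K A ≤ Fintype.card ι) :
    CompleteOrthogonalIdempotents e := by
  obtain ⟨c, hc⟩ := exists_sum_smul_of_orthogonalIdempotents he hne hcard 1
  have hsmul (i : ι) : c i • e i = e i := by
    rw [← sum_smul_mul_of_orthogonalIdempotents he (Finset.mem_univ i), hc, one_mul]
  exact ⟨he, by simpa only [hsmul] using hc⟩

end OrthogonalIdempotents

section Biproduct

variable {k G V ι : Type*} {U : ι → Type*} [CommSemiring k] [AddCommMonoid V] [Module k V]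
  [∀ i, AddCommMonoid (U i)] [∀ i, Module k (U i)] [Monoid G] {ρ : Representation k G V}
  {τ : ∀ i, Representation k G (U i)}
  {a : ∀ i, (τ i).IntertwiningMap ρ} {b : ∀ i, ρ.IntertwiningMap (τ i)}
  (hself : ∀ i, (b i).comp (a i) = .id (τ i)) (hne : ∀ i j, i ≠ j → (b i).comp (a j) = 0)

include hself hne in
theorem orthogonalIdempotents_comp : OrthogonalIdempotents fun i => (a i).comp (b i) where
  idem i := IntertwiningMap.ext <| LinearMap.ext fun v =>
    congrArg (a i) (DFunLike.congr_fun (hself i) (b i v))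
  ortho i j hij := IntertwiningMap.ext <| LinearMap.ext fun v =>
    (congrArg (a i) (DFunLike.congr_fun (hne i j hij) (b j v))).trans (map_zero _)

include hself in
theorem comp_ne_zero_of_comp_eq_id [∀ i, Nontrivial (U i)] (i : ι) :
    (a i).comp (b i) ≠ 0 := fun h => by
  obtain ⟨u, hu⟩ := exists_ne (0 : U i)
  have hba (u : U i) : b i (a i u) = u := DFunLike.congr_fun (hself i) u
  have : a i (b i (a i u)) = 0 := DFunLike.congr_fun h (a i u)
  rw [hba] at this
  exact hu (by rw [← hba u, this, map_zero])

end Biproduct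

section BiproductOfFinrankLE

variable {k G V ι : Type*} {U : ι → Type*} [Field k] [AddCommGroup V] [Module k V]
  [∀ i, AddCommGroup (U i)] [∀ i, Module k (U i)] [Monoid G] {ρ : Representation k G V}
  {τ : ∀ i, Representation k G (U i)}
  {a : ∀ i, (τ i).IntertwiningMap ρ} {b : ∀ i, ρ.IntertwiningMap (τ i)}
  (hself : ∀ i, (b i).comp (a i) = .id (τ i)) (hne : ∀ i j, i ≠ j → (b i).comp (a j) = 0)
  [∀ i, Nontrivial (U i)] [Fintype ι] [Module.Finite k (ρ.IntertwiningMap ρ)]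

include hself hne in
theorem sum_comp_eq_id_of_finrank_le
    (hcard : Module.finrank k (ρ.IntertwiningMap ρ) ≤ Fintype.card ι) :
    ∑ i, (a i).comp (b i) = .id ρ :=
  (completeOrthogonalIdempotents_of_finrank_le (orthogonalIdempotents_comp hself hne)
    (comp_ne_zero_of_comp_eq_id hself) hcard).complete

include hself hne in
theorem finrank_intertwiningMap_eq_one_of_finrank_le
    (hcard : Module.finrank k (ρ.IntertwiningMap ρ) ≤ Fintype.card ι) (i : ι) :
    Module.finrank k ((τ i).IntertwiningMap ρ) = 1 := by
  refine finrank_eq_one (a i) (fun h => comp_ne_zero_of_comp_eq_id hself i ?_) fun ψ => ?_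
  · rw [h]; rfl
  have hba (u : U i) : b i (a i u) = u := DFunLike.congr_fun (hself i) u
  have hψ : ψ.comp (b i) * (a i).comp (b i) = ψ.comp (b i) :=
    IntertwiningMap.ext (LinearMap.ext fun v => congrArg ψ (hba (b i v)))
  obtain ⟨c, hc⟩ := exists_smul_eq_of_mul_orthogonalIdempotent (K := k)
    (orthogonalIdempotents_comp hself hne) (comp_ne_zero_of_comp_eq_id hself) hcard hψ
  refine ⟨c, IntertwiningMap.ext (LinearMap.ext fun u => ?_)⟩
  have := DFunLike.congr_fun hc (a i u)
  change c • a i (b i (a i u)) = ψ (b i (a i u)) at this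
  rwa [hba] at this

end BiproductOfFinrankLE

section DirectSum

variable {k G V ι : Type*} {U : ι → Type*} [CommSemiring k] [AddCommMonoid V] [Module k V]
  [∀ i, AddCommMonoid (U i)] [∀ i, Module k (U i)] [Monoid G] (τ : ∀ i, Representation k G (U i))

/-- The projection of a direct sum of representations onto a summand. -/
noncomputable def directSumProj (i : ι) : (directSum τ).IntertwiningMap (τ i) where
  toLinearMap := DirectSum.component k ι U i
  isIntertwining' _ := rfl

variable [DecidableEq ι]

/-- The inclusion of a summand of a direct sum of representations. -/
noncomputable def directSumIncl (i : ι) : (τ i).IntertwiningMap (directSum τ) where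
  toLinearMap := DirectSum.lof k ι U i
  isIntertwining' g := LinearMap.ext fun u => (DirectSum.lmap_lof (fun i => τ i g) i u).symm

theorem directSumProj_comp_directSumIncl_self (i : ι) :
    (directSumProj τ i).comp (directSumIncl τ i) = .id (τ i) :=
  IntertwiningMap.ext (LinearMap.ext fun u => DirectSum.component.lof_self k i u)

theorem directSumProj_comp_directSumIncl_of_ne {i j : ι} (h : i ≠ j) :
    (directSumProj τ i).comp (directSumIncl τ j) = 0 :=
  IntertwiningMap.ext (LinearMap.ext fun u => DirectSum.of_eq_of_ne j i u h)

variable {τ} {ρ : Representation k G V}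

/-- The intertwining map out of a direct sum that restricts to `φ i` on the summand `i`. -/
noncomputable def directSumLift (φ : ∀ i, (τ i).IntertwiningMap ρ) :
    (directSum τ).IntertwiningMap ρ where
  toLinearMap := DirectSum.toModule k ι V fun i => (φ i).toLinearMap
  isIntertwining' g := DirectSum.linearMap_ext k fun i => LinearMap.ext fun u => by
    simp only [LinearMap.comp_apply, directSum_apply, DirectSum.lmap_lof, DirectSum.toModule_lof]
    exact (φ i).isIntertwining _ _ g u

theorem directSumLift_lof (φ : ∀ i, (τ i).IntertwiningMap ρ) (i : ι) (u : U i) :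
    directSumLift φ (DirectSum.lof k ι U i u) = φ i u :=
  DirectSum.toModule_lof k i u

theorem directSumLift_apply (φ : ∀ i, (τ i).IntertwiningMap ρ) [∀ i, DecidableEq (U i)]
    (x : ⨁ i, U i) :
    directSumLift φ x = ∑ i ∈ x.support, φ i (x i) := by
  conv_lhs => rw [← DirectSum.sum_support_of x]
  rw [map_sum]
  exact Finset.sum_congr rfl fun i _ => directSumLift_lof φ i (x i)

end DirectSum

theorem directSumLift_injective {k G V W ι α : Type*} {U : ι → Type*} [CommSemiring k]
    [AddCommMonoid V] [Module k V] [AddCommMonoid W] [Module k W] [∀ i, AddCommGroup (U i)]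
    [∀ i, Module k (U i)] [Monoid G] [DecidableEq ι] [PartialOrder α]
    {τ : ∀ i, Representation k G (U i)} {ρ : Representation k G V}
    {φ : ∀ i, (τ i).IntertwiningMap ρ} {d : ι → α} (hd : Function.Injective d) {S : ι → Type*}
    (D : ∀ i, S i → V →ₗ[k] W) (hzero : ∀ i s j, ¬ d j ≤ d i → ∀ u, D i s (φ j u) = 0)
    (hker : ∀ i u, (∀ s, D i s (φ i u) = 0) → u = 0) :
    Function.Injective (directSumLift φ) := by
  classical
  refine (injective_iff_map_eq_zero _).2 fun x hx => ?_
  by_contra hx0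
  obtain ⟨i, hi, hmin⟩ := x.support.exists_minimalFor d <|
    Finset.nonempty_iff_ne_empty.2 (mt DFinsupp.support_eq_empty.1 hx0)
  refine DFinsupp.mem_support_iff.1 hi (hker i _ fun s => ?_)
  have hsum : ∑ j ∈ x.support, D i s (φ j (x j)) = D i s (φ i (x i)) :=
    Finset.sum_eq_single_of_mem i hi fun j hj hji => hzero i s j
      (fun hle => hji (hd (hle.antisymm (hmin hj hle)))) _
  rw [← hsum, ← map_sum, ← directSumLift_apply, hx, map_zero]

section Maschke

variable {k G V ι : Type*} {U : ι → Type*} [Field k] [AddCommGroup V] [Module k V]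
  [∀ i, AddCommGroup (U i)] [∀ i, Module k (U i)] [Group G] [Finite G]
  [NeZero (Nat.card G : k)] {ρ : Representation k G V}

theorem exists_intertwiningMap_leftInverse {W : Type*} [AddCommGroup W] [Module k W]
    {σ : Representation k G W} {φ : σ.IntertwiningMap ρ} (hφ : Function.Injective φ) :
    ∃ r : ρ.IntertwiningMap σ, r.comp φ = .id σ := by
  obtain ⟨r, hr⟩ := MonoidAlgebra.exists_leftInverse_of_injective
    (IntertwiningMap.equivLinearMapAsModule σ ρ φ) (LinearMap.ker_eq_bot.2 hφ)
  exact ⟨(IntertwiningMap.equivLinearMapAsModule ρ σ).symm r,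
    IntertwiningMap.ext (LinearMap.ext fun w => LinearMap.congr_fun hr w)⟩

theorem bijective_and_finrank_eq_one_of_injective [Fintype ι]
    [∀ i, Nontrivial (U i)] [Module.Finite k (ρ.IntertwiningMap ρ)]
    {τ : ∀ i, Representation k G (U i)} {φ : (directSum τ).IntertwiningMap ρ}
    (hφ : Function.Injective φ)
    (hcard : Module.finrank k (ρ.IntertwiningMap ρ) ≤ Fintype.card ι) :
    Function.Bijective φ ∧ ∀ i, Module.finrank k ((τ i).IntertwiningMap ρ) = 1 := by
  classical
  obtain ⟨r, hr⟩ := exists_intertwiningMap_leftInverse hφ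
  have hrφ (v : ⨁ i, U i) : r (φ v) = v := DFunLike.congr_fun hr v
  let a (i : ι) := φ.comp (directSumIncl τ i)
  let b (i : ι) := (directSumProj τ i).comp r
  have hba (i j : ι) : (b i).comp (a j) = (directSumProj τ i).comp (directSumIncl τ j) :=
    IntertwiningMap.ext (LinearMap.ext fun u => congrArg (directSumProj τ i) (hrφ _))
  have hself (i : ι) : (b i).comp (a i) = .id (τ i) :=
    (hba i i).trans (directSumProj_comp_directSumIncl_self τ i)
  have hne (i j : ι) (h : i ≠ j) : (b i).comp (a j) = 0 :=
    (hba i j).trans (directSumProj_comp_directSumIncl_of_ne τ h)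
  refine ⟨⟨hφ, fun v => ⟨∑ i, directSumIncl τ i (b i v), ?_⟩⟩,
    finrank_intertwiningMap_eq_one_of_finrank_le hself hne hcard⟩
  have hv := DFunLike.congr_fun (sum_comp_eq_id_of_finrank_le hself hne hcard) v
  rw [IntertwiningMap.sum_apply] at hv
  rw [map_sum]
  exact hv

end Maschke

section PermutationModules

variable {k G X Y : Type*} [CommSemiring k] [Group G] [MulAction G X] [MulAction G Y]

theorem coeff_intertwiningMap_smul
    (φ : (ofMulAction k G X).IntertwiningMap (ofMulAction k G Y)) (g : G) (x : X) (y : Y) :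
    (φ (.single (g • x) 1)).coeff (g • y) = (φ (.single x 1)).coeff y := by
  rw [← ofMulAction_single, φ.isIntertwining, coeff_ofMulAction, inv_smul_smul]

/-- The matrix of an intertwining map of permutation modules, as a function on the orbits of the
pairs of basis vectors. -/
noncomputable def orbitCoeff :
    (ofMulAction k G X).IntertwiningMap (ofMulAction k G Y) →ₗ[k]
      (MulAction.orbitRel.Quotient G (X × Y) → k) where
  toFun φ := Quotient.lift (fun p => (φ (.single p.1 1)).coeff p.2) <| by
    rintro _ ⟨x, y⟩ ⟨g, rfl⟩
    exact coeff_intertwiningMap_smul φ g x y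
  map_add' φ ψ := funext <| Quotient.ind fun p => rfl
  map_smul' c φ := funext <| Quotient.ind fun p => rfl

theorem orbitCoeff_injective : Function.Injective
    (orbitCoeff : (ofMulAction k G X).IntertwiningMap (ofMulAction k G Y) →ₗ[k] _) := fun φ ψ h =>
  IntertwiningMap.ext <| (MonoidAlgebra.basis X k).ext fun x => MonoidAlgebra.ext <|
    Finsupp.ext fun y => by
    rw [MonoidAlgebra.basis_apply]
    exact congrFun h (Quotient.mk _ (x, y))

end PermutationModules

theorem finrank_intertwiningMap_ofMulAction_le {k G X Y : Type*} [CommRing k] [Nontrivial k]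
    [Group G] [MulAction G X] [MulAction G Y] [Finite (MulAction.orbitRel.Quotient G (X × Y))] :
    Module.finrank k ((ofMulAction k G X).IntertwiningMap (ofMulAction k G Y)) ≤
      Nat.card (MulAction.orbitRel.Quotient G (X × Y)) := by
  have := Fintype.ofFinite (MulAction.orbitRel.Quotient G (X × Y))
  rw [Nat.card_eq_fintype_card, ← Module.finrank_fintype_fun_eq_card k]
  exact LinearMap.finrank_le_finrank_of_injective orbitCoeff_injective

section Diagram

theorem rowLens_diagram {n : ℕ} (p : n.Partition) :
    (diagram p).rowLens = p.parts.sort (· ≥ ·) :=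
  YoungDiagram.rowLens_ofRowLens_eq_self fun _ hx => p.parts_pos ((Multiset.mem_sort _).1 hx)

theorem diagram_injective {n : ℕ} : Function.Injective (diagram (n := n)) := fun p q h => by
  have hsort := congrArg YoungDiagram.rowLens h
  rw [rowLens_diagram, rowLens_diagram] at hsort
  exact Nat.Partition.ext (by rw [← Multiset.sort_eq p.parts (· ≥ ·), hsort, Multiset.sort_eq])

theorem even_rowLen_diagram {n : ℕ} {p : n.Partition} (hp : ∀ i ∈ p.parts, Even i) (i : ℕ) :
    Even ((diagram p).rowLen i) := by
  rcases Nat.eq_zero_or_pos ((diagram p).rowLen i) with h | h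
  · exact h ▸ Even.zero
  · have hi : i < (diagram p).colLen 0 :=
      YoungDiagram.mem_iff_lt_colLen.1 (YoungDiagram.mem_iff_lt_rowLen.2 h)
    have hmem : (diagram p).rowLen i ∈ (diagram p).rowLens :=
      List.mem_map_of_mem (List.mem_range.2 hi)
    rw [rowLens_diagram] at hmem
    exact hp _ ((Multiset.mem_sort _).1 hmem)

/-- The number of cells in the first `i` rows of a Young diagram. The pointwise order on these
functions is the dominance order on diagrams. -/
def rowSum (μ : YoungDiagram) (i : ℕ) : ℕ := ∑ r ∈ Finset.range i, μ.rowLen r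

theorem rowSum_injective : Function.Injective rowSum := fun μ ν h => by
  have hlen (i : ℕ) : μ.rowLen i = ν.rowLen i := by
    have hsucc : rowSum μ (i + 1) = rowSum ν (i + 1) := congrFun h _
    rw [rowSum, rowSum, Finset.sum_range_succ, Finset.sum_range_succ] at hsucc
    exact Nat.add_left_cancel (hsucc.trans (congrArg (· + _) (congrFun h i).symm))
  ext ⟨i, j⟩
  rw [YoungDiagram.mem_cells, YoungDiagram.mem_cells, YoungDiagram.mem_iff_lt_rowLen,
    YoungDiagram.mem_iff_lt_rowLen, hlen]

end Diagram

section Tableaux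

variable {μ ν : YoungDiagram} {n : ℕ}

theorem Tabloid.mem_row {T : Tabloid μ n} {i : ℕ} {x : Fin n} : x ∈ T.row i ↔ T.rowOf x = i := by
  simp [Tabloid.row]

theorem Tabloid.card_row (T : Tabloid μ n) (i : ℕ) : (T.row i).card = μ.rowLen i := by
  obtain ⟨t, ht⟩ := T.exists_tableau
  rw [YoungDiagram.rowLen_eq_card]
  refine Finset.card_bij' (fun x _ => (t.symm x).1)
    (fun c hc => t ⟨c, (YoungDiagram.mem_row_iff.1 hc).1⟩) (fun x hx => ?_) (fun c hc => ?_)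
    (fun x _ => t.apply_symm_apply x) (fun c _ => congrArg Subtype.val (t.symm_apply_apply _))
  · rw [Tabloid.mem_row, ← ht] at hx
    exact YoungDiagram.mem_row_iff.2 ⟨(t.symm x).2, hx⟩
  · rw [Tabloid.mem_row, ← ht, Tableau.rowOf, Equiv.symm_apply_apply]
    exact (YoungDiagram.mem_row_iff.1 hc).2

theorem Tabloid.card_rowOf_lt (T : Tabloid μ n) (i : ℕ) :
    (Finset.univ.filter fun x => T.rowOf x < i).card = rowSum μ i := by
  rw [Finset.card_eq_sum_card_fiberwise (f := T.rowOf) (t := Finset.range i)]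
  · refine Finset.sum_congr rfl fun r hr => ?_
    rw [← T.card_row r, Finset.filter_filter]
    congr 1 with x
    simp only [Finset.mem_filter_univ, Tabloid.mem_row, and_iff_right_iff_imp]
    rintro rfl
    exact Finset.mem_range.1 hr
  · intro x hx
    simpa using hx

namespace Tableau

theorem eq_of_rowOf_eq_of_colOf_eq (t : Tableau μ n) {x y : Fin n} (h : t.rowOf x = t.rowOf y)
    (h' : t.colOf x = t.colOf y) : x = y :=
  t.symm.injective (Subtype.ext (Prod.ext h h'))

theorem rowOf_lt_colLen (t : Tableau μ n) (x : Fin n) : t.rowOf x < μ.colLen (t.colOf x) :=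
  YoungDiagram.mem_iff_lt_colLen.1 (t.symm x).2

/-- The entries in column `c` of a tableau. -/
def col (t : Tableau μ n) (c : ℕ) : Finset (Fin n) := Finset.univ.filter fun x => t.colOf x = c

theorem mem_col {t : Tableau μ n} {c : ℕ} {x : Fin n} : x ∈ t.col c ↔ t.colOf x = c := by
  simp [col]

theorem card_filter_rowOf_lt_col (t : Tableau μ n) (c i : ℕ) :
    ((t.col c).filter fun x => t.rowOf x < i).card = min i (μ.colLen c) := by
  rw [← Finset.card_range (min i _)]
  refine Finset.card_bij (fun x _ => t.rowOf x) (fun x hx => ?_) (fun x hx y hy h => ?_)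
    (fun r hr => ?_)
  · rw [Finset.mem_filter, mem_col] at hx
    exact Finset.mem_range.2 (lt_min hx.2 (hx.1 ▸ t.rowOf_lt_colLen x))
  · rw [Finset.mem_filter, mem_col] at hx hy
    exact t.eq_of_rowOf_eq_of_colOf_eq h (hx.1.trans hy.1.symm)
  · rw [Finset.mem_range, lt_min_iff, ← YoungDiagram.mem_iff_lt_colLen] at hr
    refine ⟨t ⟨(r, c), hr.2⟩, ?_, ?_⟩
    · rw [Finset.mem_filter, mem_col, rowOf, colOf, Equiv.symm_apply_apply]
      exact ⟨rfl, hr.1⟩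
    · rw [rowOf, Equiv.symm_apply_apply]

theorem card_col (t : Tableau μ n) (c : ℕ) : (t.col c).card = μ.colLen c := by
  rw [← min_self (μ.colLen c), ← t.card_filter_rowOf_lt_col, Finset.filter_true_of_mem]
  intro x hx
  exact mem_col.1 hx ▸ t.rowOf_lt_colLen x

theorem card_filter_eq_sum_col (t : Tableau μ n) (p : Fin n → Prop) [DecidablePred p] :
    (Finset.univ.filter p).card =
      ∑ c ∈ Finset.univ.image t.colOf, ((t.col c).filter p).card := by
  rw [Finset.card_eq_sum_card_fiberwise (f := t.colOf) (t := Finset.univ.image t.colOf)]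
  · simp only [col, Finset.filter_filter, and_comm]
  · intro x _
    simp

/-- No column of `t` contains two entries of the same row of `T`. -/
def Separates (t : Tableau μ n) (T : Tabloid ν n) : Prop :=
  ∀ x y, T.rowOf x = T.rowOf y → t.colOf x = t.colOf y → x = y

namespace Separates

variable {t : Tableau μ n}

theorem card_filter_rowOf_lt_col_le {T : Tabloid ν n} (h : t.Separates T) (c i : ℕ) :
    ((t.col c).filter fun x => T.rowOf x < i).card ≤
      ((t.col c).filter fun x => t.rowOf x < i).card := by
  rw [card_filter_rowOf_lt_col, ← t.card_col]
  refine le_min ?_ (Finset.card_filter_le _ _)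
  refine (Finset.card_le_card_of_injOn T.rowOf (t := Finset.range i) (fun x hx => ?_)
    fun x hx y hy hxy => ?_).trans_eq (Finset.card_range i)
  · exact Finset.mem_coe.2 (Finset.mem_range.2 (Finset.mem_filter.1 hx).2)
  · rw [Finset.mem_coe, Finset.mem_filter, mem_col] at hx hy
    exact h x y hxy (hx.1.trans hy.1.symm)

theorem rowSum_le {T : Tabloid ν n} (h : t.Separates T) : rowSum ν ≤ rowSum μ := fun i => by
  rw [← T.card_rowOf_lt, ← t.tabloid.card_rowOf_lt, t.card_filter_eq_sum_col,
    t.card_filter_eq_sum_col]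
  exact Finset.sum_le_sum fun c _ => h.card_filter_rowOf_lt_col_le c i

theorem card_filter_rowOf_lt_col_eq {T : Tabloid μ n} (h : t.Separates T) (x : Fin n) (i : ℕ) :
    ((t.col (t.colOf x)).filter fun y => T.rowOf y < i).card =
      ((t.col (t.colOf x)).filter fun y => t.rowOf y < i).card := by
  refine (Finset.sum_eq_sum_iff_of_le fun c _ => h.card_filter_rowOf_lt_col_le c i).1 ?_ _
    (Finset.mem_image_of_mem t.colOf (Finset.mem_univ x))
  rw [← t.card_filter_eq_sum_col, ← t.card_filter_eq_sum_col, T.card_rowOf_lt]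
  exact (t.tabloid.card_rowOf_lt i).symm

theorem rowOf_lt_colLen {T : Tabloid μ n} (h : t.Separates T) (x : Fin n) :
    T.rowOf x < μ.colLen (t.colOf x) := by
  have hcard := h.card_filter_rowOf_lt_col_eq x (μ.colLen (t.colOf x))
  rw [card_filter_rowOf_lt_col, min_self, ← t.card_col] at hcard
  exact (Finset.card_filter_eq_iff.1 hcard x (mem_col.2 rfl)).trans_eq (t.card_col _)

theorem exists_smul_tabloid_eq {T : Tabloid μ n} (h : t.Separates T) :
    ∃ π ∈ columnGroup t, π • t.tabloid = T := by
  let c (x : Fin n) : {c : ℕ × ℕ // c ∈ μ.cells} :=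
    ⟨(T.rowOf x, t.colOf x), YoungDiagram.mem_iff_lt_colLen.2 (h.rowOf_lt_colLen x)⟩
  have hc : Function.Injective c := fun x y hxy =>
    h x y (congrArg (fun c => c.1.1) hxy) (congrArg (fun c => c.1.2) hxy)
  let s : Tableau μ n := (Equiv.ofBijective c
    ((Fintype.bijective_iff_injective_and_card c).2 ⟨hc, Fintype.card_congr t.symm⟩)).symm
  refine ⟨t.symm.trans s, (Finset.mem_filter_univ _).2 fun x => ?_,
    Tabloid.ext (funext fun x => ?_)⟩
  · exact congrArg (fun c => c.1.2) (s.symm_apply_apply (t.symm x))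
  · exact congrArg (fun c => c.1.1) (t.symm_apply_apply (s.symm x))

end Separates

end Tableau

end Tableaux

section Subrepresentation

theorem nontrivial_toSubmodule_of_isAtom {k G V : Type*} [CommSemiring k] [Monoid G]
    [AddCommMonoid V] [Module k V] {ρ : Representation k G V} {σ : Subrepresentation ρ}
    (hσ : IsAtom σ) : Nontrivial σ.toSubmodule :=
  (Submodule.nontrivial_iff_ne_bot).2 fun h => hσ.1 (Subrepresentation.toSubmodule_injective h)

theorem isIrreducible_toRepresentation_of_isAtom {k G V : Type*} [Field k] [Monoid G]
    [AddCommGroup V] [Module k V] {ρ : Representation k G V} {σ : Subrepresentation ρ}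
    (hσ : IsAtom σ) :
    σ.toRepresentation.IsIrreducible where
  exists_pair_ne :=
    have := nontrivial_toSubmodule_of_isAtom hσ
    ⟨⊥, ⊤, fun h => bot_ne_top (congrArg Subrepresentation.toSubmodule h)⟩
  eq_bot_or_eq_top U := by
    let U' : Subrepresentation ρ :=
      { toSubmodule := U.toSubmodule.map σ.toSubmodule.subtype
        apply_mem_toSubmodule := by
          rintro g _ ⟨u, hu, rfl⟩
          exact ⟨_, U.apply_mem_toSubmodule g hu, rfl⟩ }
    have hU : U' ≤ σ := Submodule.map_subtype_le _ U.toSubmodule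
    refine (hσ.le_iff.1 hU).imp (fun h => ?_) fun h => ?_ <;>
      refine Subrepresentation.toSubmodule_injective (Submodule.map_injective_of_injective
        σ.toSubmodule.injective_subtype ?_)
    · exact (congrArg Subrepresentation.toSubmodule h).trans (Submodule.map_bot _).symm
    · exact (congrArg Subrepresentation.toSubmodule h).trans (Submodule.map_subtype_top _).symm

end Subrepresentation

section SpechtModule

variable {μ ν : YoungDiagram} {n : ℕ}

theorem mem_columnGroup {t : Tableau μ n} {σ : Equiv.Perm (Fin n)} :
    σ ∈ columnGroup t ↔ ∀ x, t.colOf (σ x) = t.colOf x := by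
  simp [columnGroup]

theorem one_mem_columnGroup (t : Tableau μ n) : 1 ∈ columnGroup t :=
  mem_columnGroup.2 fun _ => rfl

theorem mul_mem_columnGroup {t : Tableau μ n} {σ τ : Equiv.Perm (Fin n)} (hσ : σ ∈ columnGroup t)
    (hτ : τ ∈ columnGroup t) : σ * τ ∈ columnGroup t :=
  mem_columnGroup.2 fun x => (mem_columnGroup.1 hσ (τ x)).trans (mem_columnGroup.1 hτ x)

theorem inv_mem_columnGroup {t : Tableau μ n} {σ : Equiv.Perm (Fin n)} (hσ : σ ∈ columnGroup t) :
    σ⁻¹ ∈ columnGroup t :=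
  mem_columnGroup.2 fun x => by
    rw [← mem_columnGroup.1 hσ, ← Equiv.Perm.mul_apply, mul_inv_cancel, Equiv.Perm.one_apply]

theorem swap_mem_columnGroup {t : Tableau μ n} {x y : Fin n} (h : t.colOf x = t.colOf y) :
    Equiv.swap x y ∈ columnGroup t :=
  mem_columnGroup.2 fun z => by
    rw [Equiv.swap_apply_def]
    split_ifs with hx hy
    · rw [hx, h]
    · rw [hy, h]
    · rfl

theorem smul_tabloid_injOn_columnGroup (t : Tableau μ n) :
    Set.InjOn (fun σ : Equiv.Perm (Fin n) => σ • t.tabloid) (columnGroup t) := fun σ hσ π hπ h =>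
  inv_injective <| Equiv.ext fun x => t.eq_of_rowOf_eq_of_colOf_eq
    (congrFun (congrArg Tabloid.rowOf h) x) <| by
      rw [mem_columnGroup.1 (inv_mem_columnGroup hσ), mem_columnGroup.1 (inv_mem_columnGroup hπ)]

section ColumnAntisymmetrizer

variable {R V W : Type*} [CommRing R] [AddCommGroup V] [Module R V] [AddCommGroup W] [Module R W]
  {ρ : Representation R (Equiv.Perm (Fin n)) V} {σ : Representation R (Equiv.Perm (Fin n)) W}

/-- The action on a representation of `∑ sign(π) π`, the sum being over the column group of `t`. -/
noncomputable def colAntisymmetrizer (ρ : Representation R (Equiv.Perm (Fin n)) V)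
    (t : Tableau μ n) : V →ₗ[R] V :=
  ∑ π ∈ columnGroup t, ((Equiv.Perm.sign π : ℤ) : R) • ρ π

theorem colAntisymmetrizer_apply (t : Tableau μ n) (v : V) : colAntisymmetrizer ρ t v =
    ∑ π ∈ columnGroup t, ((Equiv.Perm.sign π : ℤ) : R) • ρ π v := by
  simp [colAntisymmetrizer]

theorem map_colAntisymmetrizer {φ : V →ₗ[R] W} (hφ : ρ.IsIntertwiningMap σ φ) (t : Tableau μ n)
    (v : V) : φ (colAntisymmetrizer ρ t v) = colAntisymmetrizer σ t (φ v) := by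
  simp only [colAntisymmetrizer_apply, map_sum, map_smul, hφ.isIntertwining]

theorem colAntisymmetrizer_mem (U : Subrepresentation ρ) (t : Tableau μ n) {v : V} (hv : v ∈ U) :
    colAntisymmetrizer ρ t v ∈ U := by
  rw [colAntisymmetrizer_apply]
  exact Submodule.sum_mem U.toSubmodule fun π _ =>
    Submodule.smul_mem _ _ (U.apply_mem_toSubmodule π hv)

theorem colAntisymmetrizer_apply_of_mem {t : Tableau μ n} {π : Equiv.Perm (Fin n)}
    (hπ : π ∈ columnGroup t) (v : V) : colAntisymmetrizer ρ t (ρ π v) =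
      ((Equiv.Perm.sign π : ℤ) : R) • colAntisymmetrizer ρ t v := by
  rw [colAntisymmetrizer_apply, colAntisymmetrizer_apply, Finset.smul_sum]
  refine Finset.sum_bij' (fun τ _ => τ * π) (fun τ _ => τ * π⁻¹)
    (fun τ hτ => mul_mem_columnGroup hτ hπ)
    (fun τ hτ => mul_mem_columnGroup hτ (inv_mem_columnGroup hπ))
    (fun τ _ => mul_inv_cancel_right τ π) (fun τ _ => inv_mul_cancel_right τ π) fun τ _ => ?_
  rw [map_mul ρ, Module.End.mul_apply, smul_smul, map_mul, mul_comm, Units.val_mul, Int.cast_mul,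
    mul_assoc, ← Int.cast_mul, ← Units.val_mul, Int.units_mul_self, Units.val_one, Int.cast_one,
    mul_one]

theorem colAntisymmetrizer_eq_zero_of_swap {t : Tableau μ n} {x y : Fin n} (hxy : x ≠ y)
    (hcol : t.colOf x = t.colOf y) {v : V} (hv : ρ (Equiv.swap x y) v = v) :
    colAntisymmetrizer ρ t v = 0 := by
  rw [colAntisymmetrizer_apply]
  refine Finset.sum_involution (fun τ _ => τ * Equiv.swap x y) (fun τ _ => ?_) (fun τ _ _ h => ?_)
    (fun τ hτ => mul_mem_columnGroup hτ (swap_mem_columnGroup hcol))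
    (fun τ _ => Equiv.mul_swap_mul_self x y τ)
  · rw [map_mul ρ, Module.End.mul_apply, hv, map_mul, Equiv.Perm.sign_swap hxy]
    simp
  · exact hxy (Equiv.swap_eq_one_iff.1 (mul_eq_left.1 h))

end ColumnAntisymmetrizer

theorem colAntisymmetrizer_single_eq_zero {t : Tableau μ n} {T : Tabloid ν n}
    (h : ¬ t.Separates T) (a : ℂ) :
    colAntisymmetrizer (permModule ν n) t (.single T a) = 0 := by
  simp only [Tableau.Separates, not_forall] at h
  obtain ⟨x, y, hrow, hcol, hxy⟩ := h
  refine colAntisymmetrizer_eq_zero_of_swap hxy hcol ?_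
  rw [ofMulAction_single]
  congr 1 with z
  change T.rowOf ((Equiv.swap x y)⁻¹ z) = T.rowOf z
  rw [Equiv.swap_inv, Equiv.swap_apply_def]
  split_ifs with hx hy
  · rw [hx, hrow]
  · rw [hy, hrow]
  · rfl

theorem colAntisymmetrizer_eq_zero_of_not_rowSum_le (t : Tableau μ n)
    (h : ¬ rowSum ν ≤ rowSum μ) (v : ℂ[Tabloid ν n]) :
    colAntisymmetrizer (permModule ν n) t v = 0 := by
  induction v using MonoidAlgebra.induction_linear with
  | zero => exact map_zero _
  | add v w hv hw => rw [map_add, hv, hw, add_zero]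
  | single T a => exact colAntisymmetrizer_single_eq_zero (fun hsep => h hsep.rowSum_le) a

theorem coeff_polytabloid [DecidableEq (Tabloid μ n)] (t : Tableau μ n) (T : Tabloid μ n) :
    (polytabloid t).coeff T = ∑ σ ∈ columnGroup t,
      if σ • t.tabloid = T then ((Equiv.Perm.sign σ : ℤ) : ℂ) else 0 := by
  rw [polytabloid, MonoidAlgebra.coeff_sum, Finset.sum_apply']
  simp only [MonoidAlgebra.coeff_single, Finsupp.single_apply]

theorem coeff_polytabloid_smul {t : Tableau μ n} {π : Equiv.Perm (Fin n)}
    (hπ : π ∈ columnGroup t) :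
    (polytabloid t).coeff (π • t.tabloid) = ((Equiv.Perm.sign π : ℤ) : ℂ) := by
  classical
  rw [coeff_polytabloid, Finset.sum_eq_single_of_mem π hπ, if_pos rfl]
  exact fun σ hσ hne => if_neg fun h => hne (smul_tabloid_injOn_columnGroup t hσ hπ h)

theorem star_coeff_polytabloid (t : Tableau μ n) :
    star ⇑(polytabloid t).coeff = (polytabloid t).coeff := by
  classical
  ext T
  simp [coeff_polytabloid, apply_ite]

theorem colAntisymmetrizer_single (t : Tableau μ n) (T : Tabloid μ n) (a : ℂ) :
    colAntisymmetrizer (permModule μ n) t (.single T a) =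
      (a * (polytabloid t).coeff T) • polytabloid t := by
  by_cases hT : ∃ π ∈ columnGroup t, π • t.tabloid = T
  · obtain ⟨π, hπ, rfl⟩ := hT
    rw [coeff_polytabloid_smul hπ, ← ofMulAction_single, colAntisymmetrizer_apply_of_mem hπ,
      mul_comm, mul_smul, polytabloid, Finset.smul_sum, colAntisymmetrizer_apply]
    simp [ofMulAction_single, mul_comm]
  · classical
    rw [colAntisymmetrizer_single_eq_zero fun hsep => hT hsep.exists_smul_tabloid_eq,
      coeff_polytabloid, Finset.sum_eq_zero fun σ hσ => if_neg fun h => hT ⟨σ, hσ, h⟩, mul_zero,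
      zero_smul]

noncomputable instance : Fintype (Tabloid μ n) :=
  @Fintype.ofFinite _ (Finite.of_surjective Tableau.tabloid fun T =>
    T.exists_tableau.imp fun _ => Tabloid.ext)

theorem colAntisymmetrizer_eq_smul_polytabloid (t : Tableau μ n) (u : ℂ[Tabloid μ n]) :
    colAntisymmetrizer (permModule μ n) t u =
      (u.coeff ⬝ᵥ (polytabloid t).coeff) • polytabloid t := by
  classical
  induction u using MonoidAlgebra.induction_linear with
  | zero => simp
  | add u v hu hv => rw [map_add, hu, hv, ← add_smul, ← add_dotProduct]; rfl
  | single T a =>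
    rw [colAntisymmetrizer_single, MonoidAlgebra.coeff_single, Finsupp.single_eq_pi_single,
      single_dotProduct]

open scoped ComplexOrder in
theorem eq_zero_of_dotProduct_polytabloid_eq_zero {u : ℂ[Tabloid μ n]} (hu : u ∈ spechtSub μ n)
    (h : ∀ t : Tableau μ n, u.coeff ⬝ᵥ (polytabloid t).coeff = 0) : u = 0 := by
  have horth (v : ℂ[Tabloid μ n]) (hv : v ∈ spechtSub μ n) : u.coeff ⬝ᵥ star ⇑v.coeff = 0 := by
    induction hv using Submodule.span_induction with
    | mem _ hv => obtain ⟨t, rfl⟩ := hv; exact (congrArg _ (star_coeff_polytabloid t)).trans (h t)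
    | zero => simp
    | add v w _ _ hv hw => simp [dotProduct_add, hv, hw]
    | smul a v _ hv => simp [hv]
  exact MonoidAlgebra.ext (DFunLike.coe_injective (dotProduct_self_star_eq_zero.1 (horth u hu)))

theorem polytabloid_ne_zero (t : Tableau μ n) : polytabloid t ≠ 0 := fun h => by
  have h1 := coeff_polytabloid_smul (one_mem_columnGroup t)
  simp [h] at h1

theorem polytabloid_mem_spechtSub (t : Tableau μ n) : polytabloid t ∈ spechtSub μ n :=
  Submodule.subset_span ⟨t, rfl⟩

theorem spechtSub_le_of_polytabloid_mem {U : Subrepresentation (permModule μ n)}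
    {t : Tableau μ n} (ht : polytabloid t ∈ U) : spechtSub μ n ≤ U := by
  refine Submodule.span_le.2 ?_
  rintro _ ⟨s, rfl⟩
  have hs : t.perm (t.symm.trans s) = s := Equiv.ext fun c => by simp [Tableau.perm]
  change polytabloid s ∈ U
  rw [← hs, ← permModule_polytabloid]
  exact U.apply_mem_toSubmodule _ ht

theorem spechtSub_le_or_dotProduct_polytabloid_eq_zero (U : Subrepresentation (permModule μ n)) :
    spechtSub μ n ≤ U ∨ ∀ u ∈ U, ∀ t : Tableau μ n, u.coeff ⬝ᵥ (polytabloid t).coeff = 0 := by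
  refine or_iff_not_imp_right.2 fun h => ?_
  push Not at h
  obtain ⟨u, hu, t, hut⟩ := h
  have hmem := colAntisymmetrizer_mem U t hu
  rw [colAntisymmetrizer_eq_smul_polytabloid] at hmem
  exact spechtSub_le_of_polytabloid_mem ((U.toSubmodule.smul_mem_iff hut).1 hmem)

theorem isAtom_spechtSub (t : Tableau μ n) : IsAtom (spechtSub μ n) := by
  refine ⟨fun h => polytabloid_ne_zero t ((Submodule.mem_bot ℂ).1 ?_), fun U hU => ?_⟩
  · exact (congrArg (polytabloid t ∈ ·) h).mp (polytabloid_mem_spechtSub t)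
  · have horth := (spechtSub_le_or_dotProduct_polytabloid_eq_zero U).resolve_left hU.not_ge
    exact Subrepresentation.toSubmodule_injective <| (Submodule.eq_bot_iff _).2 fun u hu =>
      eq_zero_of_dotProduct_polytabloid_eq_zero (hU.le hu) (horth u hu)

end SpechtModule

section PerfectMatching

variable {V : Type*} {R : Finset V} {M : Finset (Sym2 V)}

theorem IsMatching.eq_of_mem {G : SimpleGraph V} (hM : IsMatching G M) {x y z : V}
    (hy : s(x, y) ∈ M) (hz : s(x, z) ∈ M) : y = z := by
  by_contra hne
  exact hM.2 _ hy _ hz (fun h => hne (Sym2.congr_right.1 h)) x (Sym2.mem_mk_left _ _)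
    (Sym2.mem_mk_left _ _)

theorem IsPerfectMatchingOf.exists_mem (hM : IsPerfectMatchingOf R M) {x : V} (hx : x ∈ R) :
    ∃ y, s(x, y) ∈ M := by
  classical
  have hcard : (M.biUnion Sym2.toFinset).card = R.card := by
    rw [← hM.2.2, mul_comm, Finset.card_biUnion, Finset.sum_const_nat]
    · exact fun e he => Sym2.card_toFinset_of_not_isDiag e
        (SimpleGraph.not_isDiag_of_mem_edgeSet _ (hM.1.1 e he))
    · exact fun e he e' he' hne => Finset.disjoint_left.2 fun v hv hv' =>
        hM.1.2 e he e' he' hne v (Sym2.mem_toFinset.1 hv) (Sym2.mem_toFinset.1 hv')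
  have hsub : M.biUnion Sym2.toFinset ⊆ R :=
    Finset.biUnion_subset.2 fun e he v hv => hM.2.1 e he v (Sym2.mem_toFinset.1 hv)
  rw [← Finset.eq_of_subset_of_card_le hsub hcard.ge] at hx
  obtain ⟨e, he, hxe⟩ := Finset.mem_biUnion.1 hx
  obtain ⟨y, rfl⟩ := Sym2.mem_toFinset.1 hxe
  exact ⟨y, he⟩

variable [DecidableEq V] {a : V → V}

/-- The set of the pairs `{x, a x}` with `x` in `R`: the matching of `R` given by an involution `a`
without fixed points. -/
def pairSet (a : V → V) (R : Finset V) : Finset (Sym2 V) :=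
  R.image fun x => s(x, a x)

theorem mk_mem_pairSet (ha : Function.Involutive a) (hR : ∀ x ∈ R, a x ∈ R) {x y : V} :
    s(x, y) ∈ pairSet a R ↔ x ∈ R ∧ a x = y := by
  simp only [pairSet, Finset.mem_image]
  constructor
  · rintro ⟨z, hz, h⟩
    rcases Sym2.eq_iff.1 h with ⟨rfl, rfl⟩ | ⟨rfl, rfl⟩
    · exact ⟨hz, rfl⟩
    · exact ⟨hR z hz, ha z⟩
  · rintro ⟨hx, rfl⟩
    exact ⟨x, hx, rfl⟩

theorem two_mul_card_pairSet (ha : Function.Involutive a) (hne : ∀ x, a x ≠ x)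
    (hR : ∀ x ∈ R, a x ∈ R) : 2 * (pairSet a R).card = R.card := by
  rw [Finset.card_eq_sum_card_image (fun x => s(x, a x)) R, ← pairSet, mul_comm,
    Finset.sum_const_nat fun e he => ?_]
  obtain ⟨x, hx, rfl⟩ := Finset.mem_image.1 he
  rw [← Finset.card_pair (hne x).symm]
  congr 1 with y
  rw [Finset.mem_filter, Finset.mem_insert, Finset.mem_singleton, Sym2.eq_iff]
  constructor
  · rintro ⟨-, h | h⟩
    exacts [Or.inl h.1, Or.inr h.1]
  · rintro (rfl | rfl)
    exacts [⟨hx, Or.inl ⟨rfl, rfl⟩⟩, ⟨hR x hx, Or.inr ⟨rfl, ha x⟩⟩]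

theorem isPerfectMatchingOf_pairSet (ha : Function.Involutive a) (hne : ∀ x, a x ≠ x)
    (hR : ∀ x ∈ R, a x ∈ R) : IsPerfectMatchingOf R (pairSet a R) := by
  have hmem {e : Sym2 V} {v : V} (he : e ∈ pairSet a R) (hv : v ∈ e) : v ∈ R ∧ e = s(v, a v) := by
    obtain ⟨w, rfl⟩ := hv
    obtain ⟨h, rfl⟩ := (mk_mem_pairSet ha hR).1 he
    exact ⟨h, rfl⟩
  refine ⟨⟨fun e he => ?_, fun e he e' he' hee' v hv hv' => ?_⟩, fun e he v hv => (hmem he hv).1,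
    two_mul_card_pairSet ha hne hR⟩
  · obtain ⟨x, -, rfl⟩ := Finset.mem_image.1 he
    exact (hne x).symm
  · exact hee' ((hmem he hv).2.trans (hmem he' hv').2.symm)

theorem IsPerfectMatchingOf.eq_pairSet (hM : IsPerfectMatchingOf R M)
    (h : ∀ x ∈ R, s(x, a x) ∈ M) : M = pairSet a R := by
  refine Finset.Subset.antisymm (fun e he => ?_) (Finset.image_subset_iff.2 h)
  induction e using Sym2.ind with
  | _ x y =>
    have hx := hM.2.1 _ he x (Sym2.mem_mk_left _ _)
    exact hM.1.eq_of_mem he (h x hx) ▸ Finset.mem_image_of_mem _ hx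

end PerfectMatching

namespace Matchings

variable {k : ℕ}

theorem isPerfectMatchingOf_univ (M : Matchings k) : IsPerfectMatchingOf Finset.univ M.edges :=
  ⟨M.isMatching, fun _ _ v _ => Finset.mem_univ v, by
    rw [M.card_edges, Finset.card_univ, Fintype.card_fin]⟩

theorem exists_mem_edges (M : Matchings k) (x : Fin (2 * k)) : ∃ y, s(x, y) ∈ M.edges :=
  M.isPerfectMatchingOf_univ.exists_mem (Finset.mem_univ x)

/-- The involution without fixed points that exchanges the ends of every edge of a matching of
`K_{2k}`. -/
noncomputable def mate (M : Matchings k) : Equiv.Perm (Fin (2 * k)) :=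
  Function.Involutive.toPerm (fun x => (M.exists_mem_edges x).choose) fun x =>
    M.isMatching.eq_of_mem (M.exists_mem_edges _).choose_spec
      (Sym2.eq_swap ▸ (M.exists_mem_edges x).choose_spec)

theorem mk_mem_edges {M : Matchings k} {x y : Fin (2 * k)} : s(x, y) ∈ M.edges ↔ M.mate x = y :=
  ⟨fun h => M.isMatching.eq_of_mem (M.exists_mem_edges x).choose_spec h,
    fun h => h ▸ (M.exists_mem_edges x).choose_spec⟩

theorem mate_involutive (M : Matchings k) : Function.Involutive M.mate :=
  Function.Involutive.toPerm_involutive _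

theorem mate_ne (M : Matchings k) (x : Fin (2 * k)) : M.mate x ≠ x := fun h =>
  M.isMatching.1 _ (mk_mem_edges.2 h) rfl

theorem mate_injective : Function.Injective (mate : Matchings k → Equiv.Perm (Fin (2 * k))) :=
  fun M N h => Matchings.ext <| Finset.ext fun e => by
    induction e using Sym2.ind with
    | _ x y => rw [mk_mem_edges, mk_mem_edges, h]

instance : Finite (Matchings k) := Finite.of_injective mate mate_injective

theorem mate_smul (g : Equiv.Perm (Fin (2 * k))) (M : Matchings k) :
    (g • M).mate = g * M.mate * g⁻¹ := Equiv.ext fun x => by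
  refine mk_mem_edges.1 (Finset.mem_image.2 ⟨s(g⁻¹ x, M.mate (g⁻¹ x)), mk_mem_edges.2 rfl, ?_⟩)
  rw [Sym2.map_mk, ← Equiv.Perm.mul_apply, mul_inv_cancel]
  rfl

/-- The matching whose edges are the orbits of an involution without fixed points. -/
def ofInvolution (a : Fin (2 * k) → Fin (2 * k)) (ha : Function.Involutive a)
    (hne : ∀ x, a x ≠ x) : Matchings k where
  edges := pairSet a Finset.univ
  isMatching := (isPerfectMatchingOf_pairSet ha hne fun _ _ => Finset.mem_univ _).1
  card_edges := by
    have h := two_mul_card_pairSet ha hne fun _ _ => Finset.mem_univ _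
    rw [Finset.card_univ, Fintype.card_fin] at h
    exact Nat.mul_left_cancel two_pos h

theorem mate_ofInvolution {a : Fin (2 * k) → Fin (2 * k)} (ha : Function.Involutive a)
    (hne : ∀ x, a x ≠ x) (x : Fin (2 * k)) : (ofInvolution a ha hne).mate x = a x :=
  mk_mem_edges.1 ((mk_mem_pairSet ha fun _ _ => Finset.mem_univ _).2 ⟨Finset.mem_univ x, rfl⟩)

/-- Every edge of the matching lies in one row of the tabloid. -/
def IsRowwise {μ : YoungDiagram} (M : Matchings k) (T : Tabloid μ (2 * k)) : Prop :=
  ∀ x, T.rowOf (M.mate x) = T.rowOf x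

theorem isRowwise_smul_iff {μ : YoungDiagram} {M : Matchings k} {T : Tabloid μ (2 * k)}
    {g : Equiv.Perm (Fin (2 * k))} : M.IsRowwise (g • T) ↔ (g⁻¹ • M).IsRowwise T := by
  refine g⁻¹.forall_congr fun {x} => ?_
  rw [mate_smul, Equiv.Perm.mul_apply, inv_inv, ← Equiv.Perm.mul_apply g, mul_inv_cancel]
  rfl

end Matchings

section RowMatchings

variable {μ : YoungDiagram} {k : ℕ} {T : Tabloid μ (2 * k)}

theorem RowMatchings.mk_mem_matching (m : RowMatchings T) (x : Fin (2 * k)) :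
    s(x, m.union.mate x) ∈ m.matching ⟨T.rowOf x, T.lt_colLen x⟩ := by
  obtain ⟨i, -, hi⟩ := Finset.mem_biUnion.1
    (Matchings.mk_mem_edges.2 rfl : s(x, m.union.mate x) ∈ m.union.edges)
  have hx := (m.isPerfect i).2.1 _ hi x (Sym2.mem_mk_left _ _)
  rwa [show i = ⟨T.rowOf x, T.lt_colLen x⟩ from Fin.ext (Tabloid.mem_row.1 hx).symm] at hi

theorem RowMatchings.matching_eq_pairSet (m : RowMatchings T) (i : Fin (μ.colLen 0)) :
    m.matching i = pairSet m.union.mate (T.row i) :=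
  (m.isPerfect i).eq_pairSet fun x hx => by
    simpa only [Tabloid.mem_row.1 hx] using m.mk_mem_matching x

theorem RowMatchings.union_injective :
    Function.Injective (RowMatchings.union : RowMatchings T → Matchings k) := fun m m' h =>
  RowMatchings.ext <| funext fun i => by
    rw [m.matching_eq_pairSet, m'.matching_eq_pairSet, h]

theorem RowMatchings.isRowwise_union (m : RowMatchings T) : m.union.IsRowwise T := fun x =>
  Tabloid.mem_row.1 ((m.isPerfect _).2.1 _ (m.mk_mem_matching x) _ (Sym2.mem_mk_right _ _))

theorem Matchings.IsRowwise.exists_union_eq {M : Matchings k} (hM : M.IsRowwise T) :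
    ∃ m : RowMatchings T, m.union = M := by
  let m : RowMatchings T :=
    { matching := fun i => pairSet M.mate (T.row i)
      isPerfect := fun i => isPerfectMatchingOf_pairSet M.mate_involutive M.mate_ne fun x hx =>
        Tabloid.mem_row.2 ((hM x).trans (Tabloid.mem_row.1 hx)) }
  refine ⟨m, Matchings.mate_injective <| Equiv.ext fun x => Matchings.mk_mem_edges.1 ?_⟩
  exact Finset.mem_biUnion.2 ⟨⟨T.rowOf x, T.lt_colLen x⟩, Finset.mem_univ _,
    Finset.mem_image_of_mem _ (Tabloid.mem_row.2 rfl)⟩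

theorem coeff_f_single (a : ℂ) (M : Matchings k) [Decidable (M.IsRowwise T)] :
    (f μ k (.single T a)).coeff M = if M.IsRowwise T then a else 0 := by
  classical
  have hf : f μ k (.single T a) = ∑ m : RowMatchings T, .single m.union a := by
    have ha : MonoidAlgebra.single T a = a • MonoidAlgebra.basis (Tabloid μ (2 * k)) ℂ T := by
      rw [MonoidAlgebra.basis_apply, MonoidAlgebra.smul_single, smul_eq_mul, mul_one]
    rw [ha, map_smul, f, Module.Basis.constr_basis, Finset.smul_sum]
    simp only [MonoidAlgebra.smul_single, smul_eq_mul, mul_one]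
  rw [hf, MonoidAlgebra.coeff_sum, Finset.sum_apply']
  simp only [MonoidAlgebra.coeff_single, Finsupp.single_apply]
  split_ifs with hM
  · obtain ⟨m, rfl⟩ := hM.exists_union_eq
    simp [RowMatchings.union_injective.eq_iff]
  · exact Finset.sum_eq_zero fun m _ => if_neg fun h : m.union = M => hM (h ▸ m.isRowwise_union)

theorem f_isIntertwiningMap (μ : YoungDiagram) (k : ℕ) :
    (permModule μ (2 * k)).IsIntertwiningMap (matchingModule k) (f μ k) := by
  classical
  refine ⟨fun g v => LinearMap.congr_fun (?_ : f μ k ∘ₗ permModule μ (2 * k) g =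
    matchingModule k g ∘ₗ f μ k) v⟩
  refine (MonoidAlgebra.basis (Tabloid μ (2 * k)) ℂ).ext fun T => MonoidAlgebra.ext <|
    Finsupp.ext fun M => ?_
  rw [MonoidAlgebra.basis_apply, LinearMap.comp_apply, LinearMap.comp_apply, ofMulAction_single,
    coeff_ofMulAction, coeff_f_single, coeff_f_single]
  exact if_congr Matchings.isRowwise_smul_iff rfl rfl

end RowMatchings

theorem sign_eq_one_of_commute {α : Type*} [Fintype α] [DecidableEq α] {p : α → Prop}
    {σ a : Equiv.Perm α} (hσ : ∀ x, p (σ x) ↔ p x) (ha : ∀ x, p (a x) ↔ ¬ p x)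
    (h : Commute σ a) : Equiv.Perm.sign σ = 1 := by
  classical
  let e : {x // p x} ≃ {x // ¬ p x} := a.subtypeEquiv fun x => by rw [ha, not_not]
  have hsplit : σ = (σ.subtypePerm hσ).subtypeCongr (σ.subtypePerm fun x => not_congr (hσ x)) := by
    ext x
    by_cases hx : p x
    · rw [Equiv.Perm.subtypeCongr.left_apply _ _ hx, Equiv.Perm.subtypePerm_apply]
    · rw [Equiv.Perm.subtypeCongr.right_apply _ _ hx, Equiv.Perm.subtypePerm_apply]
  have hsign : Equiv.Perm.sign (σ.subtypePerm hσ) =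
      Equiv.Perm.sign (σ.subtypePerm fun x => not_congr (hσ x)) :=
    Equiv.Perm.sign_eq_sign_of_equiv _ _ e fun x =>
      Subtype.ext (DFunLike.congr_fun h.symm.eq (x : α))
  rw [hsplit, Equiv.Perm.sign_subtypeCongr, hsign, Int.units_mul_self]

section NeighbourMatching

theorem xor_one_lt {j l : ℕ} (h : j < l) (hl : Even l) : j ^^^ 1 < l := by
  rcases j.even_or_odd with hj | hj
  · rw [Nat.xor_one_of_even hj]
    grind
  · rw [Nat.xor_one_of_odd hj]
    omega

theorem xor_one_ne (j : ℕ) : j ^^^ 1 ≠ j := by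
  rcases j.even_or_odd with hj | hj
  · rw [Nat.xor_one_of_even hj]
    omega
  · rw [Nat.xor_one_of_odd hj]
    grind

theorem even_xor_one {j : ℕ} : Even (j ^^^ 1) ↔ ¬ Even j := by
  simp [Nat.even_xor]

namespace Tableau

variable {μ : YoungDiagram} {n k : ℕ} (hμ : ∀ i, Even (μ.rowLen i))

/-- The neighbour of an entry in its row, when the columns `2j` and `2j + 1` are paired. -/
def neighbour (t : Tableau μ n) (x : Fin n) : Fin n :=
  t ⟨(t.rowOf x, t.colOf x ^^^ 1), YoungDiagram.mem_iff_lt_rowLen.2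
    (xor_one_lt (YoungDiagram.mem_iff_lt_rowLen.1 (t.symm x).2) (hμ _))⟩

theorem rowOf_neighbour (t : Tableau μ n) (x : Fin n) :
    t.rowOf (t.neighbour hμ x) = t.rowOf x := by
  rw [neighbour, rowOf, Equiv.symm_apply_apply]

theorem colOf_neighbour (t : Tableau μ n) (x : Fin n) :
    t.colOf (t.neighbour hμ x) = t.colOf x ^^^ 1 := by
  rw [neighbour, colOf, Equiv.symm_apply_apply]

theorem neighbour_involutive (t : Tableau μ n) : Function.Involutive (t.neighbour hμ) := fun x =>
  t.eq_of_rowOf_eq_of_colOf_eq (by rw [rowOf_neighbour, rowOf_neighbour])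
    (by rw [colOf_neighbour, colOf_neighbour, Nat.xor_xor_cancel_right])

theorem neighbour_ne (t : Tableau μ n) (x : Fin n) : t.neighbour hμ x ≠ x := fun h =>
  xor_one_ne (t.colOf x) (by rw [← colOf_neighbour hμ, h])

/-- The matching that pairs every entry with its neighbour. -/
def neighbourMatching (t : Tableau μ (2 * k)) : Matchings k :=
  .ofInvolution (t.neighbour hμ) (t.neighbour_involutive hμ) (t.neighbour_ne hμ)

theorem mate_neighbourMatching (t : Tableau μ (2 * k)) (x : Fin (2 * k)) :
    (t.neighbourMatching hμ).mate x = t.neighbour hμ x :=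
  Matchings.mate_ofInvolution _ _ x

theorem isRowwise_neighbourMatching (t : Tableau μ (2 * k)) :
    (t.neighbourMatching hμ).IsRowwise t.tabloid := fun x => by
  rw [mate_neighbourMatching]
  exact t.rowOf_neighbour hμ x

theorem sign_eq_one_of_isRowwise_neighbourMatching {t : Tableau μ (2 * k)}
    {σ : Equiv.Perm (Fin (2 * k))} (hσ : σ ∈ columnGroup t)
    (h : (t.neighbourMatching hμ).IsRowwise (σ • t.tabloid)) : Equiv.Perm.sign σ = 1 := by
  have hcol := mem_columnGroup.1 (inv_mem_columnGroup hσ)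
  have hcomm : Commute σ⁻¹ (t.neighbourMatching hμ).mate := Equiv.ext fun x => by
    refine t.eq_of_rowOf_eq_of_colOf_eq ?_ ?_
    · refine (h x).trans ?_
      rw [Equiv.Perm.mul_apply, mate_neighbourMatching, rowOf_neighbour]
      rfl
    · rw [Equiv.Perm.mul_apply, Equiv.Perm.mul_apply, hcol, mate_neighbourMatching,
        mate_neighbourMatching, colOf_neighbour, colOf_neighbour, hcol]
  rw [← Equiv.Perm.sign_inv]
  refine sign_eq_one_of_commute (p := fun x => Even (t.colOf x)) (fun x => ?_) (fun x => ?_) hcomm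
  · rw [hcol]
  · rw [mate_neighbourMatching, colOf_neighbour, even_xor_one]

theorem coeff_f_polytabloid_neighbourMatching (t : Tableau μ (2 * k))
    [DecidablePred fun σ : Equiv.Perm (Fin (2 * k)) =>
      (t.neighbourMatching hμ).IsRowwise (σ • t.tabloid)] :
    (f μ k (polytabloid t)).coeff (t.neighbourMatching hμ) = ((columnGroup t).filter fun σ =>
      (t.neighbourMatching hμ).IsRowwise (σ • t.tabloid)).card := by
  classical
  rw [polytabloid, map_sum, MonoidAlgebra.coeff_sum, Finset.sum_apply', Finset.natCast_card_filter]
  refine Finset.sum_congr rfl fun σ hσ => ?_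
  rw [coeff_f_single]
  refine if_ctx_congr Iff.rfl (fun h => ?_) fun _ => rfl
  rw [sign_eq_one_of_isRowwise_neighbourMatching hμ hσ h, Units.val_one, Int.cast_one]

end Tableau

theorem f_polytabloid_ne_zero {μ : YoungDiagram} {k : ℕ} (hμ : ∀ i, Even (μ.rowLen i))
    (t : Tableau μ (2 * k)) : f μ k (polytabloid t) ≠ 0 := fun h0 => by
  classical
  have hcoeff := t.coeff_f_polytabloid_neighbourMatching hμ
  rw [h0, MonoidAlgebra.coeff_zero, Finsupp.coe_zero, Pi.zero_apply, eq_comm, Nat.cast_eq_zero,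
    Finset.card_eq_zero] at hcoeff
  exact Finset.filter_eq_empty_iff.1 hcoeff (one_mem_columnGroup t)
    (t.isRowwise_neighbourMatching hμ)

end NeighbourMatching

section InvolutionPairs

theorem exists_pred_apply_iff_not {α : Type*} {f : α → α} (hf : Function.Involutive f)
    (hne : ∀ x, f x ≠ x) : ∃ p : α → Prop, ∀ x, p (f x) ↔ ¬ p x := by
  let _ : LinearOrder α := IsWellOrder.linearOrder WellOrderingRel
  refine ⟨fun x => x < f x, fun x => ?_⟩
  simp only [hf x, not_lt]
  exact (hne x).le_iff_lt.symm

variable {V : Type*} {a b : Equiv.Perm V}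

theorem semiconjBy_mul_of_involutive (ha : Function.Involutive a) (hb : Function.Involutive b) :
    SemiconjBy a (a * b) (a * b)⁻¹ := by
  have hinv {c : Equiv.Perm V} (hc : Function.Involutive c) : c⁻¹ = c :=
    inv_eq_of_mul_eq_one_left (Equiv.ext hc)
  rw [SemiconjBy, mul_inv_rev, hinv ha, hinv hb, ← mul_assoc, mul_assoc b a a]
  ext x
  simp only [Equiv.Perm.mul_apply, ha (b x), ha x]

theorem not_sameCycle_mul_apply (ha : Function.Involutive a) (hb : Function.Involutive b)
    (ha' : ∀ x, a x ≠ x) (hb' : ∀ x, b x ≠ x) (x : V) : ¬ (a * b).SameCycle x (a x) := by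
  rintro ⟨n, hn⟩
  have hcomm (m : ℤ) : a (((a * b) ^ m) x) = ((a * b) ^ (-m)) (a x) := by
    rw [zpow_neg, ← inv_zpow]
    exact DFunLike.congr_fun ((semiconjBy_mul_of_involutive ha hb).zpow_right m).eq x
  have hshift (m : ℤ) : a (((a * b) ^ m) x) = ((a * b) ^ (n - m)) x := by
    rw [hcomm, ← hn, ← Equiv.Perm.mul_apply, ← zpow_add, neg_add_eq_sub]
  -- `a (a b) ^ n` is a conjugate of `a` or of `b`, according to the parity of `n`.
  obtain ⟨m, rfl | rfl⟩ := Int.even_or_odd' n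
  · refine ha' (((a * b) ^ m) x) ((hshift m).trans ?_)
    rw [two_mul, add_sub_cancel_right]
  · refine hb' (((a * b) ^ m) x) (a.injective (((hshift m).trans ?_).symm))
    rw [two_mul, add_sub_right_comm, add_sub_cancel_right, add_comm, zpow_one_add]
    rfl

theorem exists_pred_apply_iff_not_and (ha : Function.Involutive a) (hb : Function.Involutive b)
    (ha' : ∀ x, a x ≠ x) (hb' : ∀ x, b x ≠ x) :
    ∃ p : V → Prop, ∀ x, (p (a x) ↔ ¬ p x) ∧ (p (b x) ↔ ¬ p x) := by
  let S := Equiv.Perm.SameCycle.setoid (a * b)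
  have hmap (x y : V) (h : (a * b).SameCycle x y) : (a * b).SameCycle (a x) (a y) := by
    have hconj := mul_inv_eq_of_eq_mul (semiconjBy_mul_of_involutive ha hb).eq
    rw [← Equiv.Perm.sameCycle_inv, ← hconj]
    exact h.conj
  have hq (x : V) : Quotient.mk S (b x) = Quotient.mk S (a x) :=
    Quotient.sound ⟨1, by rw [zpow_one, Equiv.Perm.mul_apply, hb]⟩
  obtain ⟨p, hp⟩ := exists_pred_apply_iff_not (f := Quotient.map a hmap)
    (Quotient.ind fun x => congrArg (Quotient.mk S) (ha x))
    (Quotient.ind fun x h => not_sameCycle_mul_apply ha hb ha' hb' x (Quotient.exact h.symm))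
  refine ⟨fun x => p (Quotient.mk S x), fun x => ⟨hp (Quotient.mk S x), ?_⟩⟩
  simp only [hq]
  exact hp (Quotient.mk S x)

variable {ι : Type*}

/-- The involution of `ι ⊕ ι` that exchanges the point `i` of the left copy with the point `σ i` of
the right copy. -/
def twist (σ : Equiv.Perm ι) : Equiv.Perm (ι ⊕ ι) :=
  (Equiv.sumComm ι ι).trans (Equiv.sumCongr σ⁻¹ σ)

theorem twist_involutive (σ : Equiv.Perm ι) : Function.Involutive (twist σ) := by
  rintro (i | i)
  · exact congrArg Sum.inl (σ.symm_apply_apply i)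
  · exact congrArg Sum.inr (σ.apply_symm_apply i)

theorem twist_ne (σ : Equiv.Perm ι) (x : ι ⊕ ι) : twist σ x ≠ x := by
  cases x <;> exact nofun

theorem permCongr_sumCongr_twist {κ : Type*} (r : ι ≃ κ) (σ : Equiv.Perm ι) :
    (Equiv.sumCongr r r).permCongr (twist σ) = twist (r.permCongr σ) := by
  ext (i | i) <;> rfl

theorem exists_permCongr_twist (ha : Function.Involutive a) (hb : Function.Involutive b)
    (ha' : ∀ x, a x ≠ x) (hb' : ∀ x, b x ≠ x) :
    ∃ (s : Set V) (e : s ⊕ s ≃ V) (σ : Equiv.Perm s),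
      e.permCongr (twist 1) = a ∧ e.permCongr (twist σ) = b := by
  classical
  obtain ⟨p, hp⟩ := exists_pred_apply_iff_not_and ha hb ha' hb'
  let r : {x // p x} ≃ {x // ¬ p x} := a.subtypeEquiv fun x => by rw [(hp x).1, not_not]
  let e : {x // p x} ⊕ {x // p x} ≃ V :=
    (Equiv.sumCongr (Equiv.refl _) r).trans (Equiv.sumCompl p)
  let σ : Equiv.Perm {x // p x} := (a * b).subtypePerm fun x => by
    rw [Equiv.Perm.mul_apply, (hp _).1, (hp _).2, not_not]
  have hpermCongr {t : Equiv.Perm _} {c : Equiv.Perm V} (h : ∀ z, e (t z) = c (e z)) :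
      e.permCongr t = c := Equiv.ext fun v => (h _).trans (congrArg c (e.apply_symm_apply v))
  refine ⟨{x | p x}, e, σ, hpermCongr ?_, hpermCongr ?_⟩
  · rintro (x | x)
    · rfl
    · exact (ha x).symm
  · rintro (x | x)
    · exact ha (b x)
    · have h : (a * b) (b (a x)) = x := (congrArg a (hb (a x))).trans (ha x)
      exact (a * b).symm_apply_eq.2 h.symm

end InvolutionPairs

section PairsOfMatchings

variable {k : ℕ} {ι κ : Type*}

/-- The matching of `K_{2k}` that corresponds to `twist σ` when the vertices are split into two
copies of `ι`. -/
def twistMatching (e : ι ⊕ ι ≃ Fin (2 * k)) (σ : Equiv.Perm ι) : Matchings k :=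
  Matchings.ofInvolution (e.permCongr (twist σ))
    (fun x => by simp only [Equiv.permCongr_apply, Equiv.symm_apply_apply, twist_involutive σ _,
      Equiv.apply_symm_apply])
    fun x h => twist_ne σ (e.symm x) (e.eq_symm_apply.2 h)

theorem mate_twistMatching (e : ι ⊕ ι ≃ Fin (2 * k)) (σ : Equiv.Perm ι) :
    (twistMatching e σ).mate = e.permCongr (twist σ) :=
  Equiv.ext (Matchings.mate_ofInvolution _ _)

theorem smul_twistMatching (g : Equiv.Perm (Fin (2 * k))) (e : ι ⊕ ι ≃ Fin (2 * k))
    (σ : Equiv.Perm ι) : g • twistMatching e σ = twistMatching (e.trans g) σ :=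
  Matchings.mate_injective <| by
    rw [Matchings.mate_smul, mate_twistMatching, mate_twistMatching]
    rfl

theorem twistMatching_sumCongr_trans (r : ι ≃ κ) (e : κ ⊕ κ ≃ Fin (2 * k)) (σ : Equiv.Perm ι) :
    twistMatching ((Equiv.sumCongr r r).trans e) σ = twistMatching e (r.permCongr σ) :=
  Matchings.mate_injective <| by
    rw [mate_twistMatching, mate_twistMatching, ← permCongr_sumCongr_twist]
    rfl

theorem exists_smul_twistMatching_eq (e e' : ι ⊕ ι ≃ Fin (2 * k)) :
    ∃ g : Equiv.Perm (Fin (2 * k)), ∀ σ, g • twistMatching e σ = twistMatching e' σ :=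
  ⟨e.symm.trans e', fun σ => by
    rw [smul_twistMatching, ← Equiv.trans_assoc, Equiv.self_trans_symm, Equiv.refl_trans]⟩

theorem exists_twistMatching_eq (M N : Matchings k) :
    ∃ (e : Fin k ⊕ Fin k ≃ Fin (2 * k)) (σ : Equiv.Perm (Fin k)),
      twistMatching e 1 = M ∧ twistMatching e σ = N := by
  obtain ⟨s, e, σ, hM, hN⟩ := exists_permCongr_twist M.mate_involutive N.mate_involutive
    M.mate_ne N.mate_ne
  have hs : Nat.card s = k := by
    have h := Nat.card_congr e
    rw [Nat.card_sum, Nat.card_fin] at h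
    omega
  let r : Fin k ≃ s := (Finite.equivFinOfCardEq hs).symm
  refine ⟨(Equiv.sumCongr r r).trans e, r.permCongr.symm σ, Matchings.mate_injective ?_,
    Matchings.mate_injective ?_⟩
  · rwa [twistMatching_sumCongr_trans, mate_twistMatching, ← r.permCongrHom_coe, map_one]
  · rwa [twistMatching_sumCongr_trans, mate_twistMatching, Equiv.apply_symm_apply]

end PairsOfMatchings

section Counting

theorem card_conjClasses_perm_le (α : Type*) [Fintype α] :
    Nat.card (ConjClasses (Equiv.Perm α)) ≤ Nat.card (Fintype.card α).Partition := by
  classical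
  refine Nat.card_le_card_of_injective (fun c => Quotient.liftOn c Equiv.Perm.partition
    fun _ _ => Equiv.Perm.partition_eq_of_isConj.1) ?_
  rintro ⟨σ⟩ ⟨τ⟩ h
  exact Quotient.sound (Equiv.Perm.partition_eq_of_isConj.2 h)

/-- The partition of `2k` whose parts are twice the parts of a given partition of `k`. -/
def doublePartition {k : ℕ} (p : k.Partition) : EvenPartition k where
  val :=
    { parts := p.parts.map (2 * ·)
      parts_pos := fun {i} hi => by
        obtain ⟨j, hj, rfl⟩ := Multiset.mem_map.1 hi
        exact Nat.mul_pos two_pos (p.parts_pos hj)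
      parts_sum := by rw [Multiset.sum_map_mul_left, Multiset.map_id', p.parts_sum] }
  property i hi := by
    obtain ⟨j, -, rfl⟩ := Multiset.mem_map.1 hi
    exact even_two_mul j

theorem doublePartition_injective (k : ℕ) :
    Function.Injective (doublePartition : k.Partition → EvenPartition k) := fun _ _ h =>
  Nat.Partition.ext <| Multiset.map_injective (mul_right_injective₀ two_ne_zero)
    (congrArg (fun r : EvenPartition k => r.1.parts) h)

theorem card_orbitRel_matchings_le (k : ℕ) :
    Nat.card (MulAction.orbitRel.Quotient (Equiv.Perm (Fin (2 * k))) (Matchings k × Matchings k)) ≤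
      Nat.card (ConjClasses (Equiv.Perm (Fin k))) := by
  let e : Fin k ⊕ Fin k ≃ Fin (2 * k) := finSumFinEquiv.trans (finCongr (two_mul k).symm)
  let F (σ : Equiv.Perm (Fin k)) :
      MulAction.orbitRel.Quotient (Equiv.Perm (Fin (2 * k))) (Matchings k × Matchings k) :=
    Quotient.mk _ (twistMatching e 1, twistMatching e σ)
  have hF {e' : Fin k ⊕ Fin k ≃ Fin (2 * k)} {σ : Equiv.Perm (Fin k)} :
      F σ = Quotient.mk _ (twistMatching e' 1, twistMatching e' σ) := by
    obtain ⟨g, hg⟩ := exists_smul_twistMatching_eq e' e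
    exact Quotient.sound ⟨g, Prod.ext (hg 1) (hg σ)⟩
  have hconj (σ τ : Equiv.Perm (Fin k)) (h : IsConj σ τ) : F σ = F τ := by
    obtain ⟨c, rfl⟩ := isConj_iff.1 h
    rw [hF (e' := (Equiv.sumCongr c c).trans e), twistMatching_sumCongr_trans,
      twistMatching_sumCongr_trans, Equiv.permCongr_eq_mul, Equiv.permCongr_eq_mul, mul_one,
      mul_inv_cancel]
  refine Nat.card_le_card_of_surjective (Quotient.lift F hconj) ?_
  rintro ⟨M, N⟩
  obtain ⟨e', σ, rfl, rfl⟩ := exists_twistMatching_eq M N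
  exact ⟨ConjClasses.mk σ, hF⟩

theorem finrank_end_matchingModule_le (k : ℕ) :
    Module.finrank ℂ ((matchingModule k).IntertwiningMap (matchingModule k)) ≤
      Fintype.card (EvenPartition k) := by
  rw [← Nat.card_eq_fintype_card]
  have h := card_conjClasses_perm_le (Fin k)
  rw [Fintype.card_fin] at h
  exact finrank_intertwiningMap_ofMulAction_le.trans <| (card_orbitRel_matchings_le k).trans <|
    h.trans <| Nat.card_le_card_of_injective _ (doublePartition_injective k)

end Counting

section SpechtMap

variable {μ : YoungDiagram} {k : ℕ}

/-- The restriction to the Specht module of the map from tabloids to matchings. -/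
noncomputable def spechtMap (μ : YoungDiagram) (k : ℕ) :
    (spechtSub μ (2 * k)).toRepresentation.IntertwiningMap (matchingModule k) where
  toLinearMap := f μ k ∘ₗ (spechtSub μ (2 * k)).toSubmodule.subtype
  isIntertwining' g := LinearMap.ext fun u => (f_isIntertwiningMap μ k).isIntertwining g u

theorem eq_zero_of_colAntisymmetrizer_f_eq_zero (hμ : ∀ i, Even (μ.rowLen i))
    {u : ℂ[Tabloid μ (2 * k)]} (hu : u ∈ spechtSub μ (2 * k))
    (h : ∀ t : Tableau μ (2 * k), colAntisymmetrizer (matchingModule k) t (f μ k u) = 0) :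
    u = 0 := by
  refine eq_zero_of_dotProduct_polytabloid_eq_zero hu fun t => ?_
  have ht := h t
  rw [← map_colAntisymmetrizer (f_isIntertwiningMap μ k), colAntisymmetrizer_eq_smul_polytabloid,
    map_smul] at ht
  exact (smul_eq_zero.1 ht).resolve_right (f_polytabloid_ne_zero hμ t)

theorem spechtMap_injective (hμ : ∀ i, Even (μ.rowLen i)) :
    Function.Injective (spechtMap μ k) :=
  (injective_iff_map_eq_zero _).2 fun u hu =>
    Subtype.ext <| eq_zero_of_colAntisymmetrizer_f_eq_zero hμ u.2 fun t => by
      rw [show f μ k u = 0 from hu, map_zero]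

theorem directSumLift_spechtMap_injective {ι : Type*} [DecidableEq ι] {μ : ι → YoungDiagram}
    (hinj : Function.Injective μ) (hμ : ∀ i j, Even ((μ i).rowLen j)) (k : ℕ) :
    Function.Injective (directSumLift fun i => spechtMap (μ i) k) := by
  refine directSumLift_injective (rowSum_injective.comp hinj)
    (fun i (t : Tableau (μ i) (2 * k)) => colAntisymmetrizer (matchingModule k) t)
    (fun i t j hij u => ?_) fun i u hu =>
      Subtype.ext (eq_zero_of_colAntisymmetrizer_f_eq_zero (hμ i) u.2 hu)
  refine (map_colAntisymmetrizer (f_isIntertwiningMap (μ j) k) t u).symm.trans ?_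
  rw [colAntisymmetrizer_eq_zero_of_not_rowSum_le t hij, map_zero]

end SpechtMap

end SpechtMatching

theorem mainTheorem3 (k : ℕ) :
    (∀ p : SpechtMatching.EvenPartition k,
      (SpechtMatching.permModule (SpechtMatching.diagram p.1) (2 * k)).IsIntertwiningMap
        (SpechtMatching.matchingModule k) (SpechtMatching.f (SpechtMatching.diagram p.1) k) ∧
      SpechtMatching.f (SpechtMatching.diagram p.1) k
        (SpechtMatching.polytabloid
          (SpechtMatching.standardTableau (SpechtMatching.card_diagram p.1))) ≠ 0 ∧
      Function.Injective fun v : (SpechtMatching.spechtSub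
          (SpechtMatching.diagram p.1) (2 * k)).toSubmodule =>
        SpechtMatching.f (SpechtMatching.diagram p.1) k v.1) ∧
    (∃ Φ : (Representation.directSum
          fun p : SpechtMatching.EvenPartition k => SpechtMatching.specht p.1).Equiv
        (SpechtMatching.matchingModule k),
      ∀ (p : SpechtMatching.EvenPartition k)
        (v : (SpechtMatching.spechtSub (SpechtMatching.diagram p.1) (2 * k)).toSubmodule),
        Φ (DirectSum.lof ℂ (SpechtMatching.EvenPartition k)
            (fun q => (SpechtMatching.spechtSub (SpechtMatching.diagram q.1) (2 * k)).toSubmodule)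
            p v) =
          SpechtMatching.f (SpechtMatching.diagram p.1) k v.1) ∧
    (∀ p : SpechtMatching.EvenPartition k,
      (SpechtMatching.specht p.1).IsIrreducible ∧
      Module.finrank ℂ ((SpechtMatching.specht p.1).IntertwiningMap
        (SpechtMatching.matchingModule k)) = 1) := by
  open SpechtMatching Representation in
  have hrow (p : EvenPartition k) (i : ℕ) : Even ((diagram p.1).rowLen i) :=
    even_rowLen_diagram p.2 i
  have hatom (p : EvenPartition k) : IsAtom (spechtSub (diagram p.1) (2 * k)) :=
    isAtom_spechtSub (standardTableau (card_diagram p.1))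
  have hirr (p : EvenPartition k) : (specht p.1).IsIrreducible :=
    isIrreducible_toRepresentation_of_isAtom (hatom p)
  have hnontrivial (p : EvenPartition k) :
      Nontrivial (spechtSub (diagram p.1) (2 * k)).toSubmodule :=
    nontrivial_toSubmodule_of_isAtom (hatom p)
  let φ (p : EvenPartition k) := spechtMap (diagram p.1) k
  have hinj : Function.Injective (directSumLift φ) :=
    directSumLift_spechtMap_injective (diagram_injective.comp Subtype.val_injective) hrow k
  obtain ⟨hbij, hfinrank⟩ :=
    bijective_and_finrank_eq_one_of_injective hinj (finrank_end_matchingModule_le k)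
  exact ⟨fun p => ⟨f_isIntertwiningMap _ k, f_polytabloid_ne_zero (hrow p) _,
      spechtMap_injective (hrow p)⟩,
    ⟨IntertwiningMap.ofBijective _ hbij, fun p v => (directSumLift_lof φ p v :)⟩,
    fun p => ⟨hirr p, hfinrank p⟩⟩
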